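/- Let $S$ be a finite partially ordered set whose Hasse graph $\Gamma(S)$ (the undirected graph on $S$ in which two elements are joined by an edge when one of them covers the other) is connected. Let $f_S(x)=\sum_{s\le t}x_sx_t$ for $x\in\mathbb R^S$, the sum being over all ordered pairs $(s,t)\in S\times S$ with $s\le t$. Let $C(S)$ be the set of all nonzero vectors $h\in\mathbb R^S$ with $\sum_{s\in S}h_s=0$ such that either $\frac{\partial f_S}{\partial x_s}(h)\le 0$ for all $s\in S$, or $\frac{\partial f_S}{\partial x_s}(h)\ge 0$ for all $s\in S$. A poset is called a wattle if it is the union of $t>1$ pairwise disjoint chains $Z_1,\dots,Z_t$ with $|Z_i|\ge 2$ for all $i$, such that for each $i=1,\dots,t-1$ the minimal element of $Z_i$ is less than the maximal element of $Z_{i+1}$, and there are no other comparabilities between elements of different chains. If $f_S$ is positive semidefinite, i.e. $f_S(x)\ge 0$ for all $x\in\mathbb R^S$, and $C(S)=\varnothing$, then $S$ is a chain or a wattle. -/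

import Mathlib

/-- The quadratic form `f_S(x) = ∑_{s ≤ t} x_s x_t` attached to a finite poset `S`, the sum being
over all ordered pairs `(s, t)` with `s ≤ t` (so that every `x_s ^ 2` occurs once). -/
noncomputable def posetForm (S : Type*) [Fintype S] [PartialOrder S] (x : S → ℝ) : ℝ :=
  open Classical in ∑ p : S × S with p.1 ≤ p.2, x p.1 * x p.2

/-- The partial derivative `∂f/∂x_i` at the point `h`. -/
noncomputable def partialDeriv {ι : Type*} (f : (ι → ℝ) → ℝ) (i : ι) (h : ι → ℝ) : ℝ :=
  open Classical in lineDeriv ℝ f h (Pi.single i 1)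

/-- `C⁻(f)`: nonzero vectors of coordinate sum zero at which all partial derivatives of `f` are
nonpositive. -/
def CMinus {ι : Type*} [Fintype ι] (f : (ι → ℝ) → ℝ) : Set (ι → ℝ) :=
  {h | ∑ i, h i = 0 ∧ h ≠ 0 ∧ ∀ i, partialDeriv f i h ≤ 0}

/-- `C⁺(f)`: nonzero vectors of coordinate sum zero at which all partial derivatives of `f` are
nonnegative. -/
def CPlus {ι : Type*} [Fintype ι] (f : (ι → ℝ) → ℝ) : Set (ι → ℝ) :=
  {h | ∑ i, h i = 0 ∧ h ≠ 0 ∧ ∀ i, 0 ≤ partialDeriv f i h}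

/-- `C(f) = C⁺(f) ∪ C⁻(f)`. -/
def CSet {ι : Type*} [Fintype ι] (f : (ι → ℝ) → ℝ) : Set (ι → ℝ) :=
  CPlus f ∪ CMinus f

/-- A wattle: a poset that is the union of `t > 1` pairwise disjoint chains `Z_0, …, Z_{t-1}` of
at least two elements each, such that the minimal element of `Z_i` is less than the maximal
element of `Z_{i+1}` and there are no other comparisons between elements of different chains. -/
def IsWattle (S : Type*) [PartialOrder S] : Prop :=
  ∃ (t : ℕ) (Z : Fin t → Finset S),
    1 < t ∧
    (∀ s : S, ∃ i, s ∈ Z i) ∧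
    (∀ i j, i ≠ j → Disjoint (Z i) (Z j)) ∧
    (∀ i, IsChain (· ≤ ·) (Z i : Set S)) ∧
    (∀ i, 2 ≤ (Z i).card) ∧
    (∀ i j, i ≠ j → ∀ a ∈ Z i, ∀ b ∈ Z j,
      a < b ↔ (j.val = i.val + 1 ∧ IsLeast (Z i : Set S) a ∧ IsGreatest (Z j : Set S) b))

/-! Put M = `posetGram S`, so that f(x) = xᵀMx/2 and the partial derivatives at h are the entries of
Mh. Emptiness of C(S) is used in two forms. A nonzero h with Mh ≥ 0 has positive coordinate sum
(`hN`), since otherwise adding a constant vector would produce an element of C⁺. And M is positive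
definite (`hK`), since a null vector h lies in the kernel of M, and then h and -h would both have
positive sum. Structural claims follow by exhibiting test vectors that violate one of these.

Local test vectors show that an interval from a minimal to a maximal element is a chain
(`comparable_of_between`) and that an extremal element is comparable with at most two of the
opposite kind (`not_three_maximal_above` and its dual). The graph of comparable minimal-maximal
pairs has a vertex of degree at most one (`exists_extremal_end`), so by connectedness it is a path v
0, …, v r. If S is not a chain, the intervals W i between consecutive v i carry all comparabilities
and only neighbouring ones meet (`exists_zigzagCover`).

The rest is numerical. The solution y of My = 1 is positive, and summing it over the chains and
their intersections ("links") gives the linear relations of `ChainData`. Test vectors supported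
along the zigzag (`exists_tent`) give 1/n + 1/N + 1/N' > 1, where n is the size of a link and N, N'
measure the legs on its two sides. Together these force every link to be a single point
(`link_size_eq_one`). Then the masses of neighbouring chains add up to 1, so they lie alternately
above and below 1/2, while a chain with elements of its own has mass above 1/2. Hence every second
chain consists of its two endpoints alone (`parity`), and the remaining chains form the wattle. -/

open Finset Matrix

/-! ### The quadratic form and the consequences of C(S) = ∅ -/

section Gram

variable {S : Type*} [PartialOrder S]

/-- Twice the Gram matrix of `posetForm S`. -/
noncomputable def posetGram (S : Type*) [PartialOrder S] : Matrix S S ℝ :=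
  open Classical in fun s t => (if s ≤ t then 1 else 0) + (if t ≤ s then 1 else 0)

lemma posetGram_self (s : S) : posetGram S s s = 2 := by
  simp [posetGram]; norm_num

lemma posetGram_of_lt {s t : S} (h : s < t) : posetGram S s t = 1 := by
  simp [posetGram, h.le, h.not_ge]

lemma posetGram_of_gt {s t : S} (h : t < s) : posetGram S s t = 1 := by
  simp [posetGram, h.le, h.not_ge]

lemma posetGram_of_incomp {s t : S} (h : ¬ s ≤ t) (h' : ¬ t ≤ s) : posetGram S s t = 0 := by
  simp [posetGram, h, h']

lemma posetGram_comm (s t : S) : posetGram S s t = posetGram S t s := by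
  simp [posetGram, add_comm]

lemma posetGram_nonneg (s t : S) : 0 ≤ posetGram S s t := by
  unfold posetGram; positivity

lemma posetGram_transpose : (posetGram S)ᵀ = posetGram S := by
  ext s t; exact posetGram_comm t s

variable [Fintype S]

lemma dotProduct_posetGram_comm (x y : S → ℝ) :
    x ⬝ᵥ posetGram S *ᵥ y = y ⬝ᵥ posetGram S *ᵥ x := by
  rw [dotProduct_mulVec, ← mulVec_transpose, posetGram_transpose, dotProduct_comm]

lemma two_mul_posetForm (x : S → ℝ) : 2 * posetForm S x = x ⬝ᵥ posetGram S *ᵥ x := by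
  classical
  have h1 : posetForm S x = ∑ s, ∑ t, (if s ≤ t then x s * x t else 0) := by
    unfold posetForm
    rw [Finset.sum_filter, ← Finset.univ_product_univ, Finset.sum_product]
  have h2 : posetForm S x = ∑ s, ∑ t, (if t ≤ s then x s * x t else 0) := by
    rw [h1, Finset.sum_comm]
    refine Finset.sum_congr rfl fun s _ => Finset.sum_congr rfl fun t _ => ?_
    rw [mul_comm]
  rw [two_mul]
  nth_rewrite 1 [h1]
  rw [h2, ← Finset.sum_add_distrib]
  simp only [dotProduct, mulVec, Finset.mul_sum, ← Finset.sum_add_distrib]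
  refine Finset.sum_congr rfl fun s _ => Finset.sum_congr rfl fun t _ => ?_
  unfold posetGram
  split_ifs <;> ring

lemma posetForm_add_smul (h e : S → ℝ) (c : ℝ) :
    posetForm S (h + c • e) = posetForm S h + c * (e ⬝ᵥ posetGram S *ᵥ h)
      + c ^ 2 * posetForm S e := by
  have h1 := two_mul_posetForm (h + c • e)
  have h2 := two_mul_posetForm h
  have h3 := two_mul_posetForm e
  have h4 := dotProduct_posetGram_comm h e
  simp only [mulVec_add, mulVec_smul, add_dotProduct, dotProduct_add, smul_dotProduct,
    dotProduct_smul, smul_eq_mul] at h1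
  rw [h4] at h1
  linear_combination h1 / 2 - h2 / 2 - c ^ 2 * h3 / 2

lemma posetForm_single [DecidableEq S] (s : S) : posetForm S (Pi.single s 1) = 1 := by
  have := two_mul_posetForm (Pi.single s (1 : ℝ))
  simp only [single_dotProduct, mulVec_single, MulOpposite.op_one, one_smul, one_mul,
    col_apply, posetGram_self] at this
  linarith

/-- Along a coordinate line f is a quadratic polynomial whose linear coefficient is the entry of Mh.
-/
lemma partialDeriv_posetForm (h : S → ℝ) (s : S) :
    partialDeriv (posetForm S) s h = (posetGram S *ᵥ h) s := by
  classical
  have key : HasLineDerivAt ℝ (posetForm S) ((posetGram S *ᵥ h) s) h (Pi.single s 1) := by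
    have : (fun t : ℝ => posetForm S (h + t • (Pi.single s (1 : ℝ) : S → ℝ))) =
        fun t => posetForm S h + t * (posetGram S *ᵥ h) s + t ^ 2 := by
      funext t
      rw [posetForm_add_smul, single_dotProduct, posetForm_single]
      ring
    unfold HasLineDerivAt
    rw [this]
    have := (((hasDerivAt_id (0 : ℝ)).mul_const ((posetGram S *ᵥ h) s)).const_add
      (posetForm S h)).add ((hasDerivAt_id (0 : ℝ)).pow 2)
    convert this using 1
    · funext t; simp
    · simp
  unfold partialDeriv
  rw [← key.lineDeriv]

/-- A vector with nonnegative partial derivatives has positive coordinate sum when `C(S)` is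
empty. -/
lemma sum_pos_of_mulVec_nonneg (hC : CSet (posetForm S) = ∅) {h : S → ℝ} (h0 : h ≠ 0)
    (hM : ∀ s, 0 ≤ (posetGram S *ᵥ h) s) : 0 < ∑ s, h s := by
  classical
  by_contra hneg
  push Not at hneg
  obtain ⟨s₀, hs₀⟩ := Function.ne_iff.mp h0
  have : Nonempty S := ⟨s₀⟩
  have hcard : (0 : ℝ) < Fintype.card S := by exact_mod_cast Fintype.card_pos
  -- This shift makes the coordinate sum zero; as c ≥ 0 and M has nonnegative entries, Mh stays
  -- nonnegative.
  set c : ℝ := -(∑ s, h s) / Fintype.card S with hc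
  have hc0 : 0 ≤ c := div_nonneg (by linarith) hcard.le
  have hM' : ∀ s, (posetGram S *ᵥ (fun _ => c)) s = (posetGram S *ᵥ (fun _ => (1 : ℝ))) s * c := by
    intro s
    simp [mulVec, dotProduct, Finset.sum_mul]
  have hpos : ∀ s, 1 ≤ (posetGram S *ᵥ (fun _ => (1 : ℝ))) s := by
    intro s
    have : posetGram S s s ≤ (posetGram S *ᵥ (fun _ => (1 : ℝ))) s := by
      simp only [mulVec, dotProduct, mul_one]
      exact Finset.single_le_sum (f := fun t => posetGram S s t)
        (fun t _ => posetGram_nonneg s t) (Finset.mem_univ s)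
    rw [posetGram_self] at this
    linarith
  have hmem : (h + fun _ => c) ∈ CSet (posetForm S) := by
    left
    refine ⟨?_, ?_, ?_⟩
    · simp only [Pi.add_apply, Finset.sum_add_distrib, Finset.sum_const, Finset.card_univ,
        nsmul_eq_mul, hc]
      field_simp
      ring
    -- If the shifted vector vanishes, then h = -c, and Mh ≥ 0 with M1 ≥ 1 forces c = 0, so h = 0.
    · intro hz
      have hh : h = fun _ => -c := by
        funext s
        have := congrFun hz s
        simp only [Pi.add_apply, Pi.zero_apply] at this
        linarith
      have h1 := hM s₀
      have h2 : (posetGram S *ᵥ h) s₀ = -((posetGram S *ᵥ (fun _ => (1 : ℝ))) s₀ * c) := by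
        rw [hh]
        simp [mulVec, dotProduct, Finset.sum_mul]
      have h3 : c = 0 := by nlinarith [hpos s₀]
      apply hs₀
      rw [hh, h3]
      simp
    · intro i
      rw [partialDeriv_posetForm, mulVec_add, Pi.add_apply, hM']
      have := hM i
      have := hpos i
      positivity
  rw [hC] at hmem
  exact hmem

/-- A positive semidefinite `posetForm S` with `C(S) = ∅` is positive definite. -/
lemma dotProduct_mulVec_pos (hpsd : ∀ x : S → ℝ, 0 ≤ posetForm S x)
    (hC : CSet (posetForm S) = ∅) {h : S → ℝ} (h0 : h ≠ 0) :
    0 < h ⬝ᵥ posetGram S *ᵥ h := by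
  classical
  by_contra hneg
  push Not at hneg
  have hf : posetForm S h = 0 := by
    have := two_mul_posetForm h
    have := hpsd h
    linarith
  have hz : ∀ s, (posetGram S *ᵥ h) s = 0 := by
    intro s
    -- The minimum of f on the line through h in direction s: its value is -(Mh)_s²/4.
    have := hpsd (h + (-(posetGram S *ᵥ h) s / 2) • (Pi.single s (1 : ℝ) : S → ℝ))
    rw [posetForm_add_smul, single_dotProduct, posetForm_single, hf] at this
    have h2 : (posetGram S *ᵥ h) s ^ 2 ≤ 0 := by nlinarith
    exact pow_eq_zero_iff (two_ne_zero) |>.mp (le_antisymm h2 (sq_nonneg _))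
  have h1 := sum_pos_of_mulVec_nonneg hC h0 (fun s => (hz s).ge)
  have h2 := sum_pos_of_mulVec_nonneg hC (neg_ne_zero.mpr h0) (fun s => by
    rw [mulVec_neg, Pi.neg_apply, hz s, neg_zero])
  simp only [Pi.neg_apply, Finset.sum_neg_distrib] at h2
  linarith

/-- The positive vector at which all partial derivatives equal one. -/
lemma exists_pos_mulVec_eq_one (hpsd : ∀ x : S → ℝ, 0 ≤ posetForm S x)
    (hC : CSet (posetForm S) = ∅) :
    ∃ y : S → ℝ, (∀ s, 0 < y s) ∧ ∀ s, (posetGram S *ᵥ y) s = 1 := by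
  classical
  have hinj : Function.Injective (posetGram S).mulVecLin := by
    rw [← LinearMap.ker_eq_bot, LinearMap.ker_eq_bot']
    intro h hh
    by_contra h0
    have := dotProduct_mulVec_pos hpsd hC h0
    rw [← mulVecLin_apply, hh] at this
    simp at this
  have hsurj : Function.Surjective (posetGram S).mulVecLin :=
    LinearMap.injective_iff_surjective.mp hinj
  obtain ⟨y, hy⟩ := hsurj (fun _ => 1)
  rw [mulVecLin_apply] at hy
  refine ⟨y, fun s => ?_, fun s => congrFun hy s⟩
  -- By symmetry of M, the entry y s is the coordinate sum of M⁻¹e_s, to which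
  -- `sum_pos_of_mulVec_nonneg` applies.
  obtain ⟨h, hh⟩ := hsurj (Pi.single s 1)
  rw [mulVecLin_apply] at hh
  have h0 : h ≠ 0 := by
    rintro rfl
    have := congrFun hh s
    simp at this
  have h1 := sum_pos_of_mulVec_nonneg hC h0 (fun t => by
    rw [hh]
    by_cases hts : t = s
    · subst hts; simp
    · simp [Pi.single_eq_of_ne hts])
  have h2 := dotProduct_posetGram_comm h y
  rw [hy, hh, dotProduct_single, mul_one] at h2
  rw [← h2]
  simpa [dotProduct] using h1

end Gram

/-! ### Four-element test vectors: intervals are chains -/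

section Local

variable {S : Type*} [PartialOrder S]

lemma posetGram_of_comparable {s t : S} (hne : s ≠ t) (h : s ≤ t ∨ t ≤ s) :
    posetGram S s t = 1 := by
  rcases h with h | h
  · exact posetGram_of_lt (lt_of_le_of_ne h hne)
  · exact posetGram_of_gt (lt_of_le_of_ne h hne.symm)

lemma sum_posetGram_of_mem {X : Finset S} (hX : ∀ u ∈ X, ∀ v ∈ X, u ≤ v ∨ v ≤ u) {t : S}
    (ht : t ∈ X) : ∑ u ∈ X, posetGram S t u = X.card + 1 := by
  classical
  rw [← Finset.add_sum_erase X _ ht, posetGram_self]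
  have : ∑ u ∈ X.erase t, posetGram S t u = ∑ u ∈ X.erase t, (1 : ℝ) := by
    refine Finset.sum_congr rfl fun u hu => ?_
    rw [Finset.mem_erase] at hu
    exact posetGram_of_comparable hu.1.symm (hX t ht u hu.2)
  rw [this, Finset.sum_const, Finset.card_erase_of_mem ht, nsmul_eq_mul, mul_one,
    Nat.cast_sub (Finset.card_pos.mpr ⟨t, ht⟩)]
  push_cast
  ring

lemma sum_posetGram_of_comparable {X : Finset S} {t : S} (ht : t ∉ X)
    (h : ∀ u ∈ X, t ≤ u ∨ u ≤ t) : ∑ u ∈ X, posetGram S t u = X.card := by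
  have : ∑ u ∈ X, posetGram S t u = ∑ u ∈ X, (1 : ℝ) := by
    refine Finset.sum_congr rfl fun u hu => ?_
    exact posetGram_of_comparable (fun e => ht (e ▸ hu)) (h u hu)
  rw [this, Finset.sum_const, nsmul_eq_mul, mul_one]

lemma sum_posetGram_of_incomp {X : Finset S} {t : S}
    (h : ∀ u ∈ X, ¬ t ≤ u ∧ ¬ u ≤ t) : ∑ u ∈ X, posetGram S t u = 0 :=
  Finset.sum_eq_zero fun u hu => posetGram_of_incomp (h u hu).1 (h u hu).2

lemma sum_posetGram_nonneg (X : Finset S) (t : S) : 0 ≤ ∑ u ∈ X, posetGram S t u :=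
  Finset.sum_nonneg fun u _ => posetGram_nonneg t u

lemma posetGram_orderDual (s t : S) :
    posetGram Sᵒᵈ (OrderDual.toDual s) (OrderDual.toDual t) = posetGram S s t := by
  exact add_comm _ _

variable [Fintype S]

lemma posetGram_mulVec_indicator (X : Finset S) [DecidablePred (· ∈ X)] (t : S) :
    (posetGram S *ᵥ fun u => if u ∈ X then (1 : ℝ) else 0) t = ∑ u ∈ X, posetGram S t u := by
  simp only [mulVec, dotProduct, mul_ite, mul_one, mul_zero]
  rw [← Finset.sum_filter]
  congr 1
  ext u
  simp

omit [PartialOrder S] in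
lemma indicator_dotProduct (X : Finset S) [DecidablePred (· ∈ X)] (p : S → ℝ) :
    (fun u => if u ∈ X then (1 : ℝ) else 0) ⬝ᵥ p = ∑ u ∈ X, p u := by
  simp only [dotProduct, ite_mul, one_mul, zero_mul]
  rw [← Finset.sum_filter]
  congr 1
  ext u
  simp

/-- Two incomparable elements cannot have two incomparable common upper bounds. -/
lemma comparable_or_comparable
    (hK : ∀ h : S → ℝ, h ≠ 0 → 0 < h ⬝ᵥ posetGram S *ᵥ h) {a a' b b' : S}
    (hab : a < b) (hab' : a < b') (ha'b : a' < b) (ha'b' : a' < b') :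
    (a ≤ a' ∨ a' ≤ a) ∨ (b ≤ b' ∨ b' ≤ b) := by
  classical
  by_contra hcon
  push Not at hcon
  obtain ⟨⟨h1, h2⟩, h3, h4⟩ := hcon
  have hne : a ≠ a' := fun e => h1 e.le
  -- The alternating vector on a 4-cycle of comparabilities is null: 4·2 - 8 = 0.
  have := hK (Pi.single a 1 + Pi.single a' 1 - Pi.single b 1 - Pi.single b' 1) (by
    intro h
    have := congrFun h a
    simp [hne, hab.ne, hab'.ne] at this)
  simp only [sub_dotProduct, add_dotProduct, single_dotProduct, mulVec_add, mulVec_sub,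
    mulVec_single, MulOpposite.op_one, one_smul, one_mul, Pi.add_apply, Pi.sub_apply, col_apply,
    posetGram_self, posetGram_of_lt hab, posetGram_of_lt hab', posetGram_of_lt ha'b,
    posetGram_of_lt ha'b', posetGram_of_gt hab, posetGram_of_gt hab', posetGram_of_gt ha'b,
    posetGram_of_gt ha'b', posetGram_of_incomp h1 h2, posetGram_of_incomp h2 h1,
    posetGram_of_incomp h3 h4, posetGram_of_incomp h4 h3] at this
  norm_num at this

/-- The interval between a minimal and a maximal element is a chain. -/
lemma comparable_of_between
    (hK : ∀ h : S → ℝ, h ≠ 0 → 0 < h ⬝ᵥ posetGram S *ᵥ h)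
    (hN : ∀ h : S → ℝ, h ≠ 0 → (∀ s, 0 ≤ (posetGram S *ᵥ h) s) → 0 < ∑ s, h s)
    {a m b c : S} (ha : IsMin a) (hm : IsMax m)
    (hab : a ≤ b) (hac : a ≤ c) (hbm : b ≤ m) (hcm : c ≤ m) : b ≤ c ∨ c ≤ b := by
  classical
  by_contra hcon
  push Not at hcon
  obtain ⟨h1, h2⟩ := hcon
  have hab : a < b := lt_of_le_of_ne hab (by rintro rfl; exact h1 hac)
  have hac : a < c := lt_of_le_of_ne hac (by rintro rfl; exact h2 hab.le)
  have hbm : b < m := lt_of_le_of_ne hbm (by rintro rfl; exact h2 hcm)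
  have hcm : c < m := lt_of_le_of_ne hcm (by rintro rfl; exact h1 hbm.le)
  have ham := hab.trans hbm
  -- This vector has sum zero, so it suffices to check that M maps it to a nonnegative vector.
  have := hN (Pi.single a 1 + Pi.single m 1 - Pi.single b 1 - Pi.single c 1) (by
    intro h
    have := congrFun h a
    simp [ham.ne, hab.ne, hac.ne] at this) (by
    intro t
    simp only [mulVec_add, mulVec_sub,
      mulVec_single, MulOpposite.op_one, one_smul, Pi.add_apply, Pi.sub_apply, col_apply]
    by_cases hta : t = a
    · subst hta
      rw [posetGram_self, posetGram_of_lt ham, posetGram_of_lt hab, posetGram_of_lt hac]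
      norm_num
    by_cases htm : t = m
    · subst htm
      rw [posetGram_self, posetGram_of_gt ham, posetGram_of_gt hbm, posetGram_of_gt hcm]
      norm_num
    by_cases htb : t = b
    · subst htb
      rw [posetGram_self, posetGram_of_gt hab, posetGram_of_lt hbm, posetGram_of_incomp h1 h2]
      norm_num
    by_cases htc : t = c
    · subst htc
      rw [posetGram_self, posetGram_of_gt hac, posetGram_of_lt hcm, posetGram_of_incomp h2 h1]
      norm_num
    -- An element comparable with b is comparable with a or m, which pays for b. If it misses the
    -- other of a and m, the 4-cycle exclusion prevents it from being comparable with c as well.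
    have key : ∀ b c : S, a < b → b < m → a < c → c < m → ¬ b ≤ c → ¬ c ≤ b → t ≠ b → t ≠ c →
        (t ≤ b ∨ b ≤ t) →
        0 ≤ posetGram S t a + posetGram S t m - posetGram S t b - posetGram S t c := by
      intro b c hab hbm hac hcm h1 h2 htb htc htcomp
      rw [posetGram_of_comparable htb htcomp]
      rcases htcomp with htb' | htb'
      · have htb' : t < b := lt_of_le_of_ne htb' htb
        rw [posetGram_of_lt (htb'.trans hbm)]
        by_cases hta' : a ≤ t
        · rw [posetGram_of_gt (lt_of_le_of_ne hta' (Ne.symm hta))]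
          by_cases h : t ≤ c ∨ c ≤ t
          · rw [posetGram_of_comparable htc h]; norm_num
          · push Not at h
            rw [posetGram_of_incomp h.1 h.2]; norm_num
        · have hta'' : ¬ t ≤ a := fun h => hta (ha.eq_of_le h)
          rw [posetGram_of_incomp hta'' hta']
          have h3 : ¬ t ≤ c := by
            intro h
            rcases comparable_or_comparable hK hab hac htb' (lt_of_le_of_ne h htc) with
              (h | h) | (h | h) <;> contradiction
          have h4 : ¬ c ≤ t := fun h => h2 (h.trans htb'.le)
          rw [posetGram_of_incomp h3 h4]
          norm_num
      · have htb' : b < t := lt_of_le_of_ne htb' (Ne.symm htb)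
        rw [posetGram_of_gt (hab.trans htb')]
        by_cases htm' : t ≤ m
        · rw [posetGram_of_lt (lt_of_le_of_ne htm' htm)]
          by_cases h : t ≤ c ∨ c ≤ t
          · rw [posetGram_of_comparable htc h]; norm_num
          · push Not at h
            rw [posetGram_of_incomp h.1 h.2]; norm_num
        · have hta'' : ¬ m ≤ t := fun h => htm (hm.eq_of_ge h)
          rw [posetGram_of_incomp htm' hta'']
          have h3 : ¬ c ≤ t := by
            intro h
            rcases comparable_or_comparable hK hbm htb' hcm (lt_of_le_of_ne h (Ne.symm htc)) with
              (h | h) | (h | h) <;> contradiction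
          have h4 : ¬ t ≤ c := fun h => h1 (htb'.le.trans h)
          rw [posetGram_of_incomp h4 h3]
          norm_num
    by_cases h3 : t ≤ b ∨ b ≤ t
    · exact key b c hab hbm hac hcm h1 h2 htb htc h3
    by_cases h4 : t ≤ c ∨ c ≤ t
    · have := key c b hac hcm hab hbm h2 h1 htc htb h4
      linarith
    push Not at h3 h4
    rw [posetGram_of_incomp h3.1 h3.2, posetGram_of_incomp h4.1 h4.2]
    have := posetGram_nonneg t a
    have := posetGram_nonneg t m
    linarith)
  simp [Finset.sum_add_distrib, Finset.sum_sub_distrib] at this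

end Local

/-! ### Extremal elements have at most two opposite neighbours -/

section Claw

variable {S : Type*} [PartialOrder S] [Fintype S]

/-- If the minimal element `a` lies below three maximal elements, then the elements below one of
them and not above `a` form a chain. -/
lemma comparable_of_not_ge
    (hK : ∀ h : S → ℝ, h ≠ 0 → 0 < h ⬝ᵥ posetGram S *ᵥ h) {a b c d : S}
    (ha : IsMin a) (hb : IsMax b) (hc : IsMax c) (hd : IsMax d)
    (hab : a < b) (hac : a < c) (had : a < d) (hbc : b ≠ c) (hbd : b ≠ d) (hcd : c ≠ d)
    {u u' : S} (hu : u < b) (hu' : u' < b) (hau : ¬ a ≤ u) (hau' : ¬ a ≤ u') :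
    u ≤ u' ∨ u' ≤ u := by
  classical
  by_contra hcon
  push Not at hcon
  obtain ⟨h1, h2⟩ := hcon
  have hua : ¬ u ≤ a := fun h => hau (ha.eq_of_le h).ge
  have hua' : ¬ u' ≤ a := fun h => hau' (ha.eq_of_le h).ge
  have hcross : ∀ m, IsMax m → a < m → b ≠ m → ∀ v, v < b → ¬ a ≤ v → ¬ v ≤ a → 
      posetGram S v m = 0 ∧ posetGram S m v = 0 := by
    intro m hm ham hbm v hv hav hva
    have hvm : ¬ v ≤ m := by
      intro h
      rcases lt_or_eq_of_le h with h | rfl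
      · rcases comparable_or_comparable hK hab ham hv h with (h | h) | (h | h)
        · exact hav h
        · exact hva h
        · exact hbm (hb.eq_of_le h)
        · exact hbm (hm.eq_of_le h).symm
      · exact hbm (hm.eq_of_le hv.le).symm
    have hmv : ¬ m ≤ v := fun h => hbm (hm.eq_of_le (h.trans hv.le)).symm
    exact ⟨posetGram_of_incomp hvm hmv, posetGram_of_incomp hmv hvm⟩
  have hmax : ∀ m n : S, IsMax m → IsMax n → m ≠ n → posetGram S m n = 0 := by
    intro m n hm hn hmn
    exact posetGram_of_incomp (fun h => hmn (hm.eq_of_le h)) (fun h => hmn (hn.eq_of_le h).symm)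
  obtain ⟨e1, e2⟩ := hcross c hc hac hbc u hu hau hua
  obtain ⟨e3, e4⟩ := hcross d hd had hbd u hu hau hua
  obtain ⟨e5, e6⟩ := hcross c hc hac hbc u' hu' hau' hua'
  obtain ⟨e7, e8⟩ := hcross d hd had hbd u' hu' hau' hua'
  -- With alternating signs, this is the null root of the extended Dynkin diagram D̃₅: inner nodes a
  -- and b, leaves c, d at a and u, u' at b.
  have := hK (Pi.single a 2 - Pi.single b 2 - Pi.single c 1 - Pi.single d 1
    + Pi.single u 1 + Pi.single u' 1) (by
    intro h
    have := congrFun h a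
    have n1 : a ≠ u := fun e => hau e.le
    have n2 : a ≠ u' := fun e => hau' e.le
    simp [n1, n2, hab.ne, hac.ne, had.ne] at this)
  simp only [sub_dotProduct, add_dotProduct, single_dotProduct, mulVec_add, mulVec_sub,
    mulVec_single, MulOpposite.op_one, one_smul, one_mul, Pi.add_apply, Pi.sub_apply, col_apply,
    Pi.smul_apply, MulOpposite.smul_eq_mul_unop, MulOpposite.unop_op,
    posetGram_self, posetGram_of_lt hab, posetGram_of_lt hac, posetGram_of_lt had,
    posetGram_of_gt hab, posetGram_of_gt hac, posetGram_of_gt had, posetGram_of_lt hu,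
    posetGram_of_gt hu, posetGram_of_lt hu', posetGram_of_gt hu', posetGram_of_incomp h1 h2,
    posetGram_of_incomp h2 h1, posetGram_of_incomp hau hua, posetGram_of_incomp hua hau,
    posetGram_of_incomp hau' hua', posetGram_of_incomp hua' hau', hmax b c hb hc hbc,
    hmax c b hc hb hbc.symm, hmax b d hb hd hbd, hmax d b hd hb hbd.symm, hmax c d hc hd hcd,
    hmax d c hd hc hcd.symm, e1, e2, e3, e4, e5, e6, e7, e8] at this
  norm_num at this

set_option maxHeartbeats 1000000 in
-- A weighted test vector h satisfies Mh ≥ 0, has form value κ and coordinate sum -κ, where κ = 1/N₁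
-- + 1/N₂ + 1/N₃ - 1. Positive definiteness gives κ > 0, whereas `hN` requires -κ > 0.
lemma not_three_maximal_above_of_meet
    (hK : ∀ h : S → ℝ, h ≠ 0 → 0 < h ⬝ᵥ posetGram S *ᵥ h)
    (hN : ∀ h : S → ℝ, h ≠ 0 → (∀ s, 0 ≤ (posetGram S *ᵥ h) s) → 0 < ∑ s, h s)
    {a w b c d : S}
    (ha : IsMin a) (hb : IsMax b) (hc : IsMax c) (hd : IsMax d)
    (hbc : b ≠ c) (hbd : b ≠ d) (hcd : c ≠ d)
    (haw : a ≤ w) (hwb : w < b) (hwd : w < d) (hac : a < c)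
    (hA : ∀ x, a < x → x ≤ w → ¬ x < c)
    (hbd' : ∀ t, w < t → t < b → ¬ t < d) (hbc' : ∀ t, w < t → t < b → ¬ t < c)
    (hcd' : ∀ t, w < t → t < c → ¬ t < d) : False := by
  classical
  have hab : a < b := haw.trans_lt hwb
  have had : a < d := haw.trans_lt hwd
  have hmax : ∀ m n : S, IsMax m → IsMax n → m ≠ n → ¬ m ≤ n := 
    fun m n hm hn hmn h => hmn (hm.eq_of_le h)
  have hmin : ∀ u, ¬ a ≤ u → ¬ u ≤ a := fun u hu h => hu (ha.eq_of_le h).ge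
  -- elements below a maximal element and not above `a` meet nothing else
  have hcross : ∀ m n, IsMax m → IsMax n → a < m → a < n → m ≠ n → ∀ u, u < m → ¬ a ≤ u →
      ¬ u ≤ n := by
    intro m n hm hn ham han hmn u hu hau h
    rcases lt_or_eq_of_le h with h | rfl
    · rcases comparable_or_comparable hK ham han hu h with (h | h) | (h | h)
      · exact hau h
      · exact hmin u hau h
      · exact hmax _ _ hm hn hmn h
      · exact hmax _ _ hn hm hmn.symm h
    · exact hmax _ _ hn hm hmn.symm hu.le
  -- A is the trunk from a to the branching point w; B, C, D are the legs hanging below b, c, d away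
  -- from a. All four are chains.
  set A : Finset S := univ.filter (fun x => a ≤ x ∧ x ≤ w) with hAdef
  set B : Finset S := univ.filter (fun u => u < b ∧ ¬ a ≤ u) with hBdef
  set C : Finset S := univ.filter (fun u => u < c ∧ ¬ a ≤ u) with hCdef
  set D : Finset S := univ.filter (fun u => u < d ∧ ¬ a ≤ u) with hDdef
  have memA : ∀ {x}, x ∈ A ↔ a ≤ x ∧ x ≤ w := by simp [hAdef]
  have memB : ∀ {x}, x ∈ B ↔ x < b ∧ ¬ a ≤ x := by simp [hBdef]
  have memC : ∀ {x}, x ∈ C ↔ x < c ∧ ¬ a ≤ x := by simp [hCdef]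
  have memD : ∀ {x}, x ∈ D ↔ x < d ∧ ¬ a ≤ x := by simp [hDdef]
  have chA : ∀ x ∈ A, ∀ y ∈ A, x ≤ y ∨ y ≤ x := by
    intro x hx y hy
    rw [memA] at hx hy
    exact comparable_of_between hK hN ha hb hx.1 hy.1 (hx.2.trans hwb.le) (hy.2.trans hwb.le)
  have chB : ∀ x ∈ B, ∀ y ∈ B, x ≤ y ∨ y ≤ x := by
    intro x hx y hy
    rw [memB] at hx hy
    exact comparable_of_not_ge hK ha hb hc hd hab hac had hbc hbd hcd hx.1 hy.1 hx.2 hy.2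
  have chC : ∀ x ∈ C, ∀ y ∈ C, x ≤ y ∨ y ≤ x := by
    intro x hx y hy
    rw [memC] at hx hy
    exact comparable_of_not_ge hK ha hc hb hd hac hab had hbc.symm hcd hbd hx.1 hy.1 hx.2 hy.2
  have chD : ∀ x ∈ D, ∀ y ∈ D, x ≤ y ∨ y ≤ x := by
    intro x hx y hy
    rw [memD] at hx hy
    exact comparable_of_not_ge hK ha hd hb hc had hab hac hbd.symm hcd.symm hbc hx.1 hy.1 hx.2 hy.2
  have legs : ∀ m n, IsMax m → IsMax n → a < m → a < n → m ≠ n → ∀ u v, u < m → ¬ a ≤ u →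
      v < n → ¬ a ≤ v → ¬ u ≤ v :=
    fun m n hm hn ham han hmn u v hu hau hv _ h =>
      hcross m n hm hn ham han hmn u hu hau (h.trans hv.le)
  set N₁ : ℝ := B.card + 2 with hN₁
  set N₂ : ℝ := D.card + 2 with hN₂
  set N₃ : ℝ := A.card + C.card + 1 with hN₃
  have hN₁0 : 0 < N₁ := by positivity
  have hN₂0 : 0 < N₂ := by positivity
  have hN₃0 : 0 < N₃ := by positivity
  have ei₁ : (B.card : ℝ) * N₁⁻¹ = 1 - 2 * N₁⁻¹ := by
    have : (B.card : ℝ) = N₁ - 2 := by rw [hN₁]; ring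
    rw [this]; field_simp
  have ei₂ : (D.card : ℝ) * N₂⁻¹ = 1 - 2 * N₂⁻¹ := by
    have : (D.card : ℝ) = N₂ - 2 := by rw [hN₂]; ring
    rw [this]; field_simp
  have ei₃ : (A.card : ℝ) * N₃⁻¹ = 1 - (C.card + 1) * N₃⁻¹ := by
    have : (A.card : ℝ) = N₃ - (C.card + 1) := by rw [hN₃]; ring
    rw [this]; field_simp
  set ind : Finset S → S → ℝ := fun X u => if u ∈ X then 1 else 0 with hind
  -- The weights are chosen so that Mh vanishes at b, c, d and on B, C, D, and is constantly κ on A;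
  -- the total weight on A, including the extra weight at a, is 1.
  set h : S → ℝ := N₃⁻¹ • ind A + N₃⁻¹ • ind C + ((C.card + 1) * N₃⁻¹) • Pi.single a 1
    - ((C.card + 1) * N₃⁻¹) • Pi.single c 1 + N₁⁻¹ • ind B - (1 - N₁⁻¹) • Pi.single b 1
    + N₂⁻¹ • ind D - (1 - N₂⁻¹) • Pi.single d 1 with hh
  have hval : ∀ t, (posetGram S *ᵥ h) t =
      N₃⁻¹ * ∑ u ∈ A, posetGram S t u + N₃⁻¹ * ∑ u ∈ C, posetGram S t u
      + ((C.card + 1) * N₃⁻¹) * posetGram S t a - ((C.card + 1) * N₃⁻¹) * posetGram S t c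
      + N₁⁻¹ * ∑ u ∈ B, posetGram S t u - (1 - N₁⁻¹) * posetGram S t b
      + N₂⁻¹ * ∑ u ∈ D, posetGram S t u - (1 - N₂⁻¹) * posetGram S t d := by
    intro t
    rw [hh]
    simp only [mulVec_add, mulVec_sub, mulVec_smul, Pi.add_apply, Pi.sub_apply, Pi.smul_apply,
      smul_eq_mul, mulVec_single, MulOpposite.op_one, one_smul, col_apply, hind,
      posetGram_mulVec_indicator]
  have hdot : ∀ p : S → ℝ, h ⬝ᵥ p =
      N₃⁻¹ * ∑ u ∈ A, p u + N₃⁻¹ * ∑ u ∈ C, p u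
      + ((C.card + 1) * N₃⁻¹) * p a - ((C.card + 1) * N₃⁻¹) * p c
      + N₁⁻¹ * ∑ u ∈ B, p u - (1 - N₁⁻¹) * p b
      + N₂⁻¹ * ∑ u ∈ D, p u - (1 - N₂⁻¹) * p d := by
    intro p
    rw [hh]
    simp only [add_dotProduct, sub_dotProduct, smul_dotProduct,
      smul_eq_mul, single_dotProduct, one_mul, hind, indicator_dotProduct]
  set κ : ℝ := N₁⁻¹ + N₂⁻¹ + N₃⁻¹ - 1 with hκ
  have hvA : ∀ t ∈ A, (posetGram S *ᵥ h) t = κ := by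
    intro t ht
    have ht' := memA.mp ht
    have out : ∀ m n, IsMax m → a < m → IsMax n → a < n → m ≠ n → t < n →
        ∀ u, u < m → ¬ a ≤ u → ¬ t ≤ u ∧ ¬ u ≤ t := by
      intro m n hm ham hn han hmn htn u hu hau
      exact ⟨fun e => hau (ht'.1.trans e),
        fun e => hcross m n hm hn ham han hmn u hu hau (e.trans htn.le)⟩
    have htb := ht'.2.trans_lt hwb
    have htd := ht'.2.trans_lt hwd
    rw [hval, sum_posetGram_of_mem chA ht,
      sum_posetGram_of_incomp (X := B) (fun u hu => out b d hb hab hd had hbd htd u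
        (memB.mp hu).1 (memB.mp hu).2),
      sum_posetGram_of_incomp (X := D) (fun u hu => out d b hd had hb hab hbd.symm htb u
        (memD.mp hu).1 (memD.mp hu).2),
      sum_posetGram_of_incomp (X := C) (fun u hu => out c b hc hac hb hab hbc.symm htb u
        (memC.mp hu).1 (memC.mp hu).2),
      posetGram_of_lt htb, posetGram_of_lt htd]
    by_cases hta : t = a
    · rw [hta, posetGram_self, posetGram_of_lt hac]
      linear_combination ei₃
    · have hat := lt_of_le_of_ne ht'.1 (Ne.symm hta)
      have h1 : ¬ t ≤ c := by
        intro e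
        rcases lt_or_eq_of_le e with e | rfl
        · exact hA t hat ht'.2 e
        · exact hmax _ _ hc hb hbc.symm htb.le
      have h2 : ¬ c ≤ t := fun e => hmax _ _ hc hb hbc.symm (e.trans htb.le)
      rw [posetGram_of_gt hat, posetGram_of_incomp h1 h2]
      linear_combination ei₃
  have top : ∀ m n, IsMax m → a < m → IsMax n → a < n → m ≠ n → ∀ u, u < n → ¬ a ≤ u →
      ¬ m ≤ u ∧ ¬ u ≤ m := by
    intro m n hm ham hn han hmn u hu hau
    exact ⟨fun e => hmax _ _ hm hn hmn (e.trans hu.le), hcross n m hn hm han ham hmn.symm u hu hau⟩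
  have hvb : (posetGram S *ᵥ h) b = 0 := by
    rw [hval, sum_posetGram_of_comparable (X := A)
        (fun e => absurd ((memA.mp e).2.trans_lt hwb) (lt_irrefl _))
        (fun u hu => Or.inr ((memA.mp hu).2.trans hwb.le)),
      sum_posetGram_of_comparable (X := B) (fun e => absurd (memB.mp e).1 (lt_irrefl _))
        (fun u hu => Or.inr (memB.mp hu).1.le),
      sum_posetGram_of_incomp (X := C) (fun u hu => top b c hb hab hc hac hbc u
        (memC.mp hu).1 (memC.mp hu).2),
      sum_posetGram_of_incomp (X := D) (fun u hu => top b d hb hab hd had hbd u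
        (memD.mp hu).1 (memD.mp hu).2),
      posetGram_self, posetGram_of_gt hab,
      posetGram_of_incomp (hmax b c hb hc hbc) (hmax c b hc hb hbc.symm),
      posetGram_of_incomp (hmax b d hb hd hbd) (hmax d b hd hb hbd.symm)]
    linear_combination ei₃ + ei₁
  have hvd : (posetGram S *ᵥ h) d = 0 := by
    rw [hval, sum_posetGram_of_comparable (X := A)
        (fun e => absurd ((memA.mp e).2.trans_lt hwd) (lt_irrefl _))
        (fun u hu => Or.inr ((memA.mp hu).2.trans hwd.le)),
      sum_posetGram_of_comparable (X := D) (fun e => absurd (memD.mp e).1 (lt_irrefl _))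
        (fun u hu => Or.inr (memD.mp hu).1.le),
      sum_posetGram_of_incomp (X := C) (fun u hu => top d c hd had hc hac hcd.symm u
        (memC.mp hu).1 (memC.mp hu).2),
      sum_posetGram_of_incomp (X := B) (fun u hu => top d b hd had hb hab hbd.symm u
        (memB.mp hu).1 (memB.mp hu).2),
      posetGram_self, posetGram_of_gt had,
      posetGram_of_incomp (hmax d c hd hc hcd.symm) (hmax c d hc hd hcd),
      posetGram_of_incomp (hmax d b hd hb hbd.symm) (hmax b d hb hd hbd)]
    linear_combination ei₃ + ei₂
  have hvc : (posetGram S *ᵥ h) c = 0 := by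
    have hsum : ∑ u ∈ A, posetGram S c u = 1 := by
      rw [Finset.sum_eq_single a]
      · exact posetGram_of_gt hac
      · intro x hx hxa
        have hx' := memA.mp hx
        have hax := lt_of_le_of_ne hx'.1 (Ne.symm hxa)
        refine posetGram_of_incomp
          (fun e => hmax _ _ hc hb hbc.symm (e.trans (hx'.2.trans hwb.le))) (fun e => ?_)
        rcases lt_or_eq_of_le e with e | rfl
        · exact hA x hax hx'.2 e
        · exact hmax _ _ hc hb hbc.symm (hx'.2.trans hwb.le)
      · exact fun e => absurd (memA.mpr ⟨le_rfl, haw⟩) e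
    rw [hval, hsum,
      sum_posetGram_of_comparable (X := C) (fun e => absurd (memC.mp e).1 (lt_irrefl _))
        (fun u hu => Or.inr (memC.mp hu).1.le),
      sum_posetGram_of_incomp (X := D) (fun u hu => top c d hc hac hd had hcd u
        (memD.mp hu).1 (memD.mp hu).2),
      sum_posetGram_of_incomp (X := B) (fun u hu => top c b hc hac hb hab hbc.symm u
        (memB.mp hu).1 (memB.mp hu).2),
      posetGram_self, posetGram_of_gt hac,
      posetGram_of_incomp (hmax c b hc hb hbc.symm) (hmax b c hb hc hbc),
      posetGram_of_incomp (hmax c d hc hd hcd) (hmax d c hd hc hcd.symm)]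
    ring
  have leg : ∀ m n, IsMax m → a < m → IsMax n → a < n → m ≠ n → ∀ t, t < m → ¬ a ≤ t →
      ∀ u, u < n → ¬ a ≤ u → ¬ t ≤ u ∧ ¬ u ≤ t := by
    intro m n hm ham hn han hmn t ht hat u hu hau
    exact ⟨legs m n hm hn ham han hmn t u ht hat hu hau,
      legs n m hn hm han ham hmn.symm u t hu hau ht hat⟩
  have legA : ∀ m n, IsMax m → a < m → IsMax n → a < n → m ≠ n → w < n → ∀ t, t < m → ¬ a ≤ t →
      ∀ u ∈ A, ¬ t ≤ u ∧ ¬ u ≤ t := by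
    intro m n hm ham hn han hmn hwn t ht hat u hu
    have hu' := memA.mp hu
    exact ⟨fun e => hcross m n hm hn ham han hmn t ht hat (e.trans (hu'.2.trans hwn.le)),
      fun e => hat (hu'.1.trans e)⟩
  have hvB : ∀ t ∈ B, (posetGram S *ᵥ h) t = 0 := by
    intro t ht
    obtain ⟨htb, hat⟩ := memB.mp ht
    have hc' := top c b hc hac hb hab hbc.symm t htb hat
    have hd' := top d b hd had hb hab hbd.symm t htb hat
    rw [hval, sum_posetGram_of_mem chB ht,
      sum_posetGram_of_incomp (X := A) (legA b d hb hab hd had hbd hwd t htb hat),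
      sum_posetGram_of_incomp (X := C) (fun u hu => leg b c hb hab hc hac hbc t htb hat u
        (memC.mp hu).1 (memC.mp hu).2),
      sum_posetGram_of_incomp (X := D) (fun u hu => leg b d hb hab hd had hbd t htb hat u
        (memD.mp hu).1 (memD.mp hu).2),
      posetGram_of_incomp (hmin t hat) hat, posetGram_of_incomp hc'.2 hc'.1,
      posetGram_of_incomp hd'.2 hd'.1, posetGram_of_lt htb]
    linear_combination ei₁
  have hvD : ∀ t ∈ D, (posetGram S *ᵥ h) t = 0 := by
    intro t ht
    obtain ⟨htd, hat⟩ := memD.mp ht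
    have hc' := top c d hc hac hd had hcd t htd hat
    have hb' := top b d hb hab hd had hbd t htd hat
    rw [hval, sum_posetGram_of_mem chD ht,
      sum_posetGram_of_incomp (X := A) (legA d b hd had hb hab hbd.symm hwb t htd hat),
      sum_posetGram_of_incomp (X := C) (fun u hu => leg d c hd had hc hac hcd.symm t htd hat u
        (memC.mp hu).1 (memC.mp hu).2),
      sum_posetGram_of_incomp (X := B) (fun u hu => leg d b hd had hb hab hbd.symm t htd hat u
        (memB.mp hu).1 (memB.mp hu).2),
      posetGram_of_incomp (hmin t hat) hat, posetGram_of_incomp hc'.2 hc'.1,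
      posetGram_of_incomp hb'.2 hb'.1, posetGram_of_lt htd]
    linear_combination ei₂
  have hvC : ∀ t ∈ C, (posetGram S *ᵥ h) t = 0 := by
    intro t ht
    obtain ⟨htc, hat⟩ := memC.mp ht
    have hd' := top d c hd had hc hac hcd.symm t htc hat
    have hb' := top b c hb hab hc hac hbc t htc hat
    rw [hval, sum_posetGram_of_mem chC ht,
      sum_posetGram_of_incomp (X := A) (legA c b hc hac hb hab hbc.symm hwb t htc hat),
      sum_posetGram_of_incomp (X := B) (fun u hu => leg c b hc hac hb hab hbc.symm t htc hat u
        (memB.mp hu).1 (memB.mp hu).2),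
      sum_posetGram_of_incomp (X := D) (fun u hu => leg c d hc hac hd had hcd t htc hat u
        (memD.mp hu).1 (memD.mp hu).2),
      posetGram_of_incomp (hmin t hat) hat, posetGram_of_incomp hd'.2 hd'.1,
      posetGram_of_incomp hb'.2 hb'.1, posetGram_of_lt htc]
    ring
  have hQ : h ⬝ᵥ posetGram S *ᵥ h = κ := by
    rw [hdot, Finset.sum_congr rfl hvA, Finset.sum_congr rfl hvB, Finset.sum_congr rfl hvC,
      Finset.sum_congr rfl hvD, hvb, hvc, hvd, hvA a (memA.mpr ⟨le_rfl, haw⟩)]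
    simp only [Finset.sum_const, nsmul_eq_mul]
    linear_combination κ * ei₃
  have hS : ∑ s, h s = -κ := by
    have := hdot 1
    rw [dotProduct_one] at this
    rw [this]
    simp only [Pi.one_apply, Finset.sum_const, nsmul_eq_mul, mul_one]
    linear_combination ei₁ + ei₂ + ei₃
  have h0 : h ≠ 0 := by
    intro e
    have := congrFun e b
    have n1 : b ∉ A := fun e => absurd ((memA.mp e).2.trans_lt hwb) (lt_irrefl _)
    have n2 : b ∉ B := fun e => absurd (memB.mp e).1 (lt_irrefl _)
    have n3 : b ∉ C := fun e => (memC.mp e).2 hab.le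
    have n4 : b ∉ D := fun e => (memD.mp e).2 hab.le
    simp only [hh, hind, Pi.add_apply, Pi.sub_apply, Pi.smul_apply, n1, n2, n3, n4,
      Pi.single_eq_same, Pi.single_eq_of_ne hab.ne', Pi.single_eq_of_ne hbc,
      Pi.single_eq_of_ne hbd, if_false, smul_eq_mul, mul_zero, mul_one, Pi.zero_apply] at this
    have h1 : N₁⁻¹ = 1 := by linarith
    rw [inv_eq_one] at h1
    have : (0 : ℝ) ≤ B.card := B.card.cast_nonneg
    linarith
  have hκ0 : 0 < κ := hQ ▸ hK h h0
  have hM : ∀ t, 0 ≤ (posetGram S *ᵥ h) t := by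
    intro t
    by_cases htA : t ∈ A
    · rw [hvA t htA]; exact hκ0.le
    by_cases htB : t ∈ B
    · rw [hvB t htB]
    by_cases htC : t ∈ C
    · rw [hvC t htC]
    by_cases htD : t ∈ D
    · rw [hvD t htD]
    by_cases htb : t = b
    · rw [htb, hvb]
    by_cases htc : t = c
    · rw [htc, hvc]
    by_cases htd : t = d
    · rw [htd, hvd]
    -- Elsewhere only b, c, d contribute negatively. An element not above a lies below none of them.
    -- One above a lies below at most one, by the choice of w: for c the extra weight at a
    -- compensates exactly; for b or d the element lies above all of A, whose total weight is 1.
    have sA := mul_nonneg (inv_nonneg.mpr hN₃0.le) (sum_posetGram_nonneg A t)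
    have sB := mul_nonneg (inv_nonneg.mpr hN₁0.le) (sum_posetGram_nonneg B t)
    have sC := mul_nonneg (inv_nonneg.mpr hN₃0.le) (sum_posetGram_nonneg C t)
    have sD := mul_nonneg (inv_nonneg.mpr hN₂0.le) (sum_posetGram_nonneg D t)
    have hl : 0 ≤ (C.card + 1) * N₃⁻¹ := by positivity
    have sa := mul_nonneg hl (posetGram_nonneg t a)
    have zero : ∀ m, IsMax m → t ≠ m → ¬ t ≤ m → posetGram S t m = 0 := fun m hm hne hle =>
      posetGram_of_incomp hle (fun e => hne (hm.eq_of_le e).symm)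
    rw [hval]
    by_cases hat : a ≤ t
    · have hat' : a < t := lt_of_le_of_ne hat (by
        rintro rfl
        exact htA (memA.mpr ⟨le_rfl, haw⟩))
      have hga : posetGram S t a = 1 := posetGram_of_gt hat'
      -- an element below `b` or `d` lies above `w`
      have above : ∀ m, IsMax m → w < m → t < m → w < t := by
        intro m hm hwm htm
        rcases comparable_of_between hK hN ha hm haw hat hwm.le htm.le with e | e
        · exact lt_of_le_of_ne e (by rintro rfl; exact htA (memA.mpr ⟨haw, le_rfl⟩))
        · exact absurd (memA.mpr ⟨hat, e⟩) htA
      have full : w < t → ∑ u ∈ A, posetGram S t u = A.card := fun hwt =>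
        sum_posetGram_of_comparable htA (fun u hu => Or.inr ((memA.mp hu).2.trans hwt.le))
      by_cases h1 : t < b
      · have hwt := above b hb hwb h1
        have n1 : ¬ t < d := hbd' t hwt h1
        have n2 : ¬ t < c := hbc' t hwt h1
        rw [zero d hd htd (fun e => n1 (lt_of_le_of_ne e htd)),
          zero c hc htc (fun e => n2 (lt_of_le_of_ne e htc)), posetGram_of_lt h1, full hwt, hga]
        linarith [inv_nonneg.mpr hN₁0.le]
      rw [zero b hb htb (fun e => h1 (lt_of_le_of_ne e htb))]
      by_cases h2 : t < d
      · have hwt := above d hd hwd h2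
        have n2 : ¬ t < c := fun e => hcd' t hwt e h2
        rw [zero c hc htc (fun e => n2 (lt_of_le_of_ne e htc)), posetGram_of_lt h2, full hwt, hga]
        linarith [inv_nonneg.mpr hN₂0.le]
      rw [zero d hd htd (fun e => h2 (lt_of_le_of_ne e htd)), hga]
      by_cases h3 : t < c
      · rw [posetGram_of_lt h3]
        linarith
      · rw [zero c hc htc (fun e => h3 (lt_of_le_of_ne e htc))]
        linarith
    · have n : ∀ m, IsMax m → t ≠ m → ¬ t < m → posetGram S t m = 0 := fun m hm hne hlt =>
        zero m hm hne (fun e => hlt (lt_of_le_of_ne e hne))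
      rw [n b hb htb (fun e => htB (memB.mpr ⟨e, hat⟩)), n c hc htc (fun e => htC (memC.mpr ⟨e, hat⟩)),
        n d hd htd (fun e => htD (memD.mpr ⟨e, hat⟩))]
      linarith
  have := hN h h0 hM
  linarith

/-- A minimal element lies below at most two maximal elements. -/
lemma not_three_maximal_above
    (hK : ∀ h : S → ℝ, h ≠ 0 → 0 < h ⬝ᵥ posetGram S *ᵥ h)
    (hN : ∀ h : S → ℝ, h ≠ 0 → (∀ s, 0 ≤ (posetGram S *ᵥ h) s) → 0 < ∑ s, h s)
    {a b c d : S} (ha : IsMin a) (hb : IsMax b) (hc : IsMax c) (hd : IsMax d)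
    (hab : a < b) (hac : a < c) (had : a < d) (hbc : b ≠ c) (hbd : b ≠ d) (hcd : c ≠ d) :
    False := by
  classical
  -- no element other than `a` lies between `a` and all three maximal elements
  have hmax : ∀ m n : S, IsMax m → IsMax n → m ≠ n → posetGram S m n = 0 := by
    intro m n hm hn hmn
    exact posetGram_of_incomp (fun h => hmn (hm.eq_of_le h)) (fun h => hmn (hn.eq_of_le h).symm)
  have htwin : ∀ x, a < x → x < b → x < c → x < d → False := by
    intro x hax hxb hxc hxd
    -- Null value: five squares give 10, the pair a, x gives 2, and the six cross pairs give -12.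
    have := hK (Pi.single a 1 + Pi.single x 1 - Pi.single b 1 - Pi.single c 1 - Pi.single d 1) (by
      intro h
      have := congrFun h a
      simp [hax.ne, hab.ne, hac.ne, had.ne] at this)
    simp only [sub_dotProduct, add_dotProduct, single_dotProduct, mulVec_add, mulVec_sub,
      mulVec_single, MulOpposite.op_one, one_smul, one_mul, Pi.add_apply, Pi.sub_apply, col_apply,
      posetGram_self, posetGram_of_lt hab, posetGram_of_lt hac, posetGram_of_lt had,
      posetGram_of_gt hab, posetGram_of_gt hac, posetGram_of_gt had, posetGram_of_lt hax,
      posetGram_of_gt hax, posetGram_of_lt hxb, posetGram_of_gt hxb, posetGram_of_lt hxc,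
      posetGram_of_gt hxc, posetGram_of_lt hxd, posetGram_of_gt hxd, hmax b c hb hc hbc,
      hmax c b hc hb hbc.symm, hmax b d hb hd hbd, hmax d b hd hb hbd.symm, hmax c d hc hd hcd,
      hmax d c hd hc hcd.symm] at this
    norm_num at this
  -- a maximal element among those below two of the three
  let X : Finset S := univ.filter fun w => a ≤ w ∧
    ((w < b ∧ w < d) ∨ (w < b ∧ w < c) ∨ (w < c ∧ w < d))
  have haX : a ∈ X := by simp [X, hab, had]
  obtain ⟨w, hwX, hwmax⟩ := X.exists_maximal ⟨a, haX⟩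
  simp only [X, Finset.mem_filter, Finset.mem_univ, true_and] at hwX
  obtain ⟨haw, hw⟩ := hwX
  have key : ∀ t, w < t → ¬ ((t < b ∧ t < d) ∨ (t < b ∧ t < c) ∨ (t < c ∧ t < d)) := by
    intro t hwt ht
    have htX : t ∈ X := by
      simp only [X, Finset.mem_filter, Finset.mem_univ, true_and]
      exact ⟨haw.trans hwt.le, ht⟩
    exact absurd (hwmax htX hwt.le) hwt.not_ge
  rcases hw with ⟨h1, h2⟩ | ⟨h1, h2⟩ | ⟨h1, h2⟩
  · exact not_three_maximal_above_of_meet hK hN ha hb hc hd hbc hbd hcd haw h1 h2 hac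
      (fun x hx hxw hxc => htwin x hx (hxw.trans_lt h1) hxc (hxw.trans_lt h2))
      (fun t ht e1 e2 => key t ht (by tauto)) (fun t ht e1 e2 => key t ht (by tauto))
      (fun t ht e1 e2 => key t ht (by tauto))
  · exact not_three_maximal_above_of_meet hK hN ha hb hd hc hbd hbc hcd.symm haw h1 h2 had
      (fun x hx hxw hxd => htwin x hx (hxw.trans_lt h1) (hxw.trans_lt h2) hxd)
      (fun t ht e1 e2 => key t ht (by tauto)) (fun t ht e1 e2 => key t ht (by tauto))
      (fun t ht e1 e2 => key t ht (by tauto))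
  · exact not_three_maximal_above_of_meet hK hN ha hc hb hd hbc.symm hcd hbd haw h1 h2 hab
      (fun x hx hxw hxb => htwin x hx hxb (hxw.trans_lt h1) (hxw.trans_lt h2))
      (fun t ht e1 e2 => key t ht (by tauto)) (fun t ht e1 e2 => key t ht (by tauto))
      (fun t ht e1 e2 => key t ht (by tauto))

/-- A maximal element lies above at most two minimal elements. -/
lemma not_three_minimal_below
    (hK : ∀ h : S → ℝ, h ≠ 0 → 0 < h ⬝ᵥ posetGram S *ᵥ h)
    (hN : ∀ h : S → ℝ, h ≠ 0 → (∀ s, 0 ≤ (posetGram S *ᵥ h) s) → 0 < ∑ s, h s)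
    {a b c d : S} (ha : IsMax a) (hb : IsMin b) (hc : IsMin c) (hd : IsMin d)
    (hab : b < a) (hac : c < a) (had : d < a) (hbc : b ≠ c) (hbd : b ≠ d) (hcd : c ≠ d) :
    False := by
  have e : (posetGram Sᵒᵈ : S → S → ℝ) = posetGram S := by
    funext s t
    exact posetGram_orderDual (S := S) s t
  exact not_three_maximal_above (S := Sᵒᵈ) (a := OrderDual.toDual a) (b := OrderDual.toDual b)
    (c := OrderDual.toDual c) (d := OrderDual.toDual d)
    (fun h h0 => by
      have := hK h h0
      rw [← e] at this
      exact this)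
    (fun h h0 hM => hN h h0 (fun s => by
      rw [← e]
      exact hM s))
    ha.toDual hb.toDual hc.toDual hd.toDual hab hac had hbc hbd hcd

end Claw

/-! ### Paths in graphs of maximum degree two -/

/-- In a finite graph of maximum degree two, the component of a vertex of degree at most one is an
induced path starting at that vertex. -/
lemma SimpleGraph.exists_path_enumeration {V : Type*} [Finite V] (H : SimpleGraph V)
    (hdeg : ∀ a b c d, H.Adj a b → H.Adj a c → H.Adj a d → b = c ∨ b = d ∨ c = d)
    (x : V) (hx : ∀ y z, H.Adj x y → H.Adj x z → y = z) :
    ∃ (r : ℕ) (v : ℕ → V), v 0 = x ∧ (∀ i ≤ r, ∀ j ≤ r, v i = v j → i = j) ∧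
      (∀ i < r, H.Adj (v i) (v (i + 1))) ∧
      (∀ i ≤ r, ∀ y, H.Adj (v i) y → ∃ j ≤ r, y = v j) ∧
      (∀ i ≤ r, ∀ j ≤ r, H.Adj (v i) (v j) → i + 1 = j ∨ j + 1 = i) := by
  classical
  let P : ℕ → Prop := fun r => ∃ v : ℕ → V, v 0 = x ∧ (∀ i ≤ r, ∀ j ≤ r, v i = v j → i = j) ∧
      (∀ i < r, H.Adj (v i) (v (i + 1)))
  have hP0 : P 0 := ⟨fun _ => x, rfl, fun i hi j hj _ => by omega, fun i hi => by omega⟩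
  have hbound : ∀ r, P r → r < Nat.card V := by
    rintro r ⟨v, -, hinj, -⟩
    have : Function.Injective (fun i : Fin (r + 1) => v i) := fun i j h =>
      Fin.ext (hinj i (Nat.lt_succ_iff.mp i.2) j (Nat.lt_succ_iff.mp j.2) h)
    have := Nat.card_le_card_of_injective _ this
    simp at this
    omega
  -- Take a path from x that admits none one step longer; a neighbour outside it could only be
  -- attached at its far end.
  have hmax : ∃ r, P r ∧ ¬ P (r + 1) := by
    by_contra hcon
    push Not at hcon
    have : ∀ r, P r := fun r => Nat.rec hP0 (fun r h => hcon r h) r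
    exact lt_irrefl _ (hbound _ (this (Nat.card V)))
  obtain ⟨r, ⟨v, hv0, hinj, hadj⟩, hnot⟩ := hmax
  have hnbr : ∀ i < r, ∀ y, H.Adj (v i) y → y = v (i + 1) ∨ (1 ≤ i ∧ y = v (i - 1)) := by
    intro i hi y hy
    rcases Nat.eq_zero_or_pos i with rfl | hpos
    · left
      rw [hv0] at hy
      exact hx _ _ hy (hv0 ▸ hadj 0 hi)
    · have h1 := hadj (i - 1) (by omega)
      rw [Nat.sub_add_cancel hpos] at h1
      rcases hdeg _ _ _ _ (hadj i hi) h1.symm hy with h | h | h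
      · have := hinj _ (by omega) _ (by omega) h
        omega
      · exact Or.inl h.symm
      · exact Or.inr ⟨hpos, h.symm⟩
  refine ⟨r, v, hv0, hinj, hadj, ?_, ?_⟩
  · intro i hi y hy
    rcases Nat.lt_or_eq_of_le hi with hi | rfl
    · rcases hnbr i hi y hy with h | ⟨_, h⟩
      · exact ⟨_, by omega, h⟩
      · exact ⟨_, by omega, h⟩
    · by_contra hcon
      push Not at hcon
      apply hnot
      refine ⟨Function.update v (i + 1) y, ?_, ?_, ?_⟩
      · rw [Function.update_of_ne (by omega), hv0]
      · intro p hp q hq hpq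
        rcases Nat.lt_or_eq_of_le hp with hp | rfl <;> rcases Nat.lt_or_eq_of_le hq with hq | rfl
        · rw [Function.update_of_ne (by omega), Function.update_of_ne (by omega)] at hpq
          exact hinj p (by omega) q (by omega) hpq
        · rw [Function.update_of_ne (by omega), Function.update_self] at hpq
          exact absurd hpq.symm (hcon p (by omega))
        · rw [Function.update_self, Function.update_of_ne (by omega)] at hpq
          exact absurd hpq (hcon q (by omega))
        · rfl
      · intro p hp
        rcases Nat.lt_or_eq_of_le (Nat.lt_succ_iff.mp hp) with hp | rfl
        · rw [Function.update_of_ne (by omega), Function.update_of_ne (by omega)]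
          exact hadj p hp
        · rw [Function.update_of_ne (by omega), Function.update_self]
          exact hy
  · have key : ∀ i ≤ r, ∀ j ≤ r, i < j → H.Adj (v i) (v j) → i + 1 = j := by
      intro i hi j hj hij h
      rcases hnbr i (by omega) _ h with h | ⟨_, h⟩
      · exact (hinj _ hj _ (by omega) h).symm
      · have := hinj _ hj _ (by omega) h
        omega
    intro i hi j hj h
    rcases lt_trichotomy i j with hij | rfl | hij
    · exact Or.inl (key i hi j hj hij h)
    · exact absurd h (H.loopless.irrefl _)
    · exact Or.inr (key j hj i hi hij h.symm)

/-! ### The zigzag of chains -/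

section Zigzag

variable {S : Type*} [PartialOrder S]

/-- A cover of a poset by chains `W 0, …, W (r - 1)`, where `W i` runs between the extremal elements
`v i` and `v (i + 1)`, such that only consecutive chains meet and all comparisons take place inside
the chains. -/
structure ZigzagCover (v : ℕ → S) (W : ℕ → Finset S) (r : ℕ) : Prop where
  left_mem : ∀ i < r, v i ∈ W i
  right_mem : ∀ i < r, v (i + 1) ∈ W i
  eq_empty : ∀ i, r ≤ i → W i = ∅
  cover : ∀ z, ∃ i, z ∈ W i
  consecutive : ∀ z i j, z ∈ W i → z ∈ W j → i < j → j = i + 1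
  comparable_iff : ∀ z u, (z ≤ u ∨ u ≤ z) ↔ ∃ i, z ∈ W i ∧ u ∈ W i
  inj : ∀ i ≤ r, ∀ j ≤ r, v i = v j → i = j
  extremal : ∀ i < r, (IsMin (v i) ∧ IsMax (v (i + 1))) ∨ (IsMax (v i) ∧ IsMin (v (i + 1)))

lemma ZigzagCover.lt_of_mem {v : ℕ → S} {W : ℕ → Finset S} {r : ℕ} (h : ZigzagCover v W r)
    {z : S} {i : ℕ} (hz : z ∈ W i) : i < r := by
  by_contra hcon
  rw [h.eq_empty i (by omega)] at hz
  simp at hz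

/-- Used at the end to arrange that the path starts at a maximal element. -/
lemma ZigzagCover.reverse {v : ℕ → S} {W : ℕ → Finset S} {r : ℕ} (h : ZigzagCover v W r) :
    ZigzagCover (fun i => v (r - i)) (fun i => if i < r then W (r - 1 - i) else ∅) r where
  left_mem i hi := by
    have := h.right_mem (r - 1 - i) (by omega)
    rw [show r - 1 - i + 1 = r - i by omega] at this
    simpa [hi] using this
  right_mem i hi := by
    have := h.left_mem (r - 1 - i) (by omega)
    rw [show r - 1 - i = r - (i + 1) by omega] at this
    simp only [hi, if_true]
    rw [show r - 1 - i = r - (i + 1) by omega]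
    exact this
  eq_empty i hi := by simp [hi]
  cover z := by
    obtain ⟨i, hz⟩ := h.cover z
    have hi := h.lt_of_mem hz
    refine ⟨r - 1 - i, ?_⟩
    rw [if_pos (by omega), show r - 1 - (r - 1 - i) = i by omega]
    exact hz
  consecutive z i j hi hj hij := by
    split_ifs at hi hj
    · have := h.consecutive z _ _ hj hi (by omega)
      omega
    all_goals simp at hi hj
  comparable_iff z u := by
    rw [h.comparable_iff]
    constructor
    · rintro ⟨i, hz, hu⟩
      have hi := h.lt_of_mem hz
      refine ⟨r - 1 - i, ?_⟩
      rw [if_pos (by omega), show r - 1 - (r - 1 - i) = i by omega]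
      exact ⟨hz, hu⟩
    · rintro ⟨i, hz, hu⟩
      split_ifs at hz hu
      · exact ⟨_, hz, hu⟩
      · simp at hz
  inj i hi j hj hij := by
    have := h.inj _ (by omega) _ (by omega) hij
    omega
  extremal i hi := by
    have := h.extremal (r - 1 - i) (by omega)
    rw [show r - 1 - i + 1 = r - i by omega] at this
    rw [show r - 1 - i = r - (i + 1) by omega] at this
    tauto

/-- The graph on a poset joining comparable pairs of a minimal and a maximal element. -/
def extremalGraph (S : Type*) [PartialOrder S] : SimpleGraph S where
  Adj a b := (IsMin a ∧ IsMax b ∧ a < b) ∨ (IsMin b ∧ IsMax a ∧ b < a)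
  symm := ⟨fun _ _ h => h.symm⟩
  loopless := ⟨fun a h => by rcases h with h | h <;> exact lt_irrefl _ h.2.2⟩

variable [Fintype S]

lemma exists_isMin_le (z : S) : ∃ a, IsMin a ∧ a ≤ z := by
  obtain ⟨a, ha, hm⟩ := Set.Finite.exists_le_minimal (Set.toFinite (Set.univ : Set S))
    (Set.mem_univ z)
  exact ⟨a, fun b hb => hm.2 (Set.mem_univ b) hb, ha⟩

lemma exists_isMax_ge (z : S) : ∃ a, IsMax a ∧ z ≤ a := by
  obtain ⟨a, ha, hm⟩ := Set.Finite.exists_le_maximal (Set.toFinite (Set.univ : Set S))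
    (Set.mem_univ z)
  exact ⟨a, fun b hb => hm.2 (Set.mem_univ b) hb, ha⟩

lemma extremalGraph_degree_le_two
    (hK : ∀ h : S → ℝ, h ≠ 0 → 0 < h ⬝ᵥ posetGram S *ᵥ h)
    (hN : ∀ h : S → ℝ, h ≠ 0 → (∀ s, 0 ≤ (posetGram S *ᵥ h) s) → 0 < ∑ s, h s) (a b c d : S)
    (hb : (extremalGraph S).Adj a b) (hc : (extremalGraph S).Adj a c)
    (hd : (extremalGraph S).Adj a d) : b = c ∨ b = d ∨ c = d := by
  by_contra hcon
  push Not at hcon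
  obtain ⟨h1, h2, h3⟩ := hcon
  rcases hb with hb | hb <;> rcases hc with hc | hc <;> rcases hd with hd | hd
  · exact not_three_maximal_above hK hN hb.1 hb.2.1 hc.2.1 hd.2.1 hb.2.2 hc.2.2 hd.2.2 h1 h2 h3
  · exact hb.1.not_lt hd.2.2
  · exact hb.1.not_lt hc.2.2
  · exact hb.1.not_lt hc.2.2
  · exact hc.1.not_lt hb.2.2
  · exact hc.1.not_lt hb.2.2
  · exact hd.1.not_lt hb.2.2
  · exact not_three_minimal_below hK hN hb.2.1 hb.1 hc.1 hd.1 hb.2.2 hc.2.2 hd.2.2 h1 h2 h3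

/-- Some extremal element has at most one neighbour in the extremal graph. -/
lemma exists_extremal_end [Nonempty S]
    (hK : ∀ h : S → ℝ, h ≠ 0 → 0 < h ⬝ᵥ posetGram S *ᵥ h) :
    ∃ x : S, (IsMin x ∨ IsMax x) ∧
      ∀ y z, (extremalGraph S).Adj x y → (extremalGraph S).Adj x z → y = z := by
  classical
  by_contra hcon
  push Not at hcon
  set A : Finset S := univ.filter (fun x => IsMin x)
  set B : Finset S := univ.filter (fun x => IsMax x)
  -- If every extremal element had two neighbours, Mh would be ≤ 0 on A and ≥ 0 on B, so this
  -- alternating vector would have nonpositive form.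
  set h : S → ℝ := (fun u => if u ∈ A then (1 : ℝ) else 0) - fun u => if u ∈ B then (1 : ℝ) else 0
    with hh
  have hval : ∀ t, (posetGram S *ᵥ h) t =
      ∑ u ∈ A, posetGram S t u - ∑ u ∈ B, posetGram S t u := by
    intro t
    rw [hh, mulVec_sub, Pi.sub_apply, posetGram_mulVec_indicator, posetGram_mulVec_indicator]
  have memA : ∀ {x}, x ∈ A ↔ IsMin x := by simp [A]
  have memB : ∀ {x}, x ∈ B ↔ IsMax x := by simp [B]
  have two : ∀ (X : Finset S) (t y z : S), y ∈ X → z ∈ X → y ≠ z → (t < y ∨ y < t) →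
      (t < z ∨ z < t) → 2 ≤ ∑ u ∈ X, posetGram S t u := by
    intro X t y z hy hz hyz hty htz
    have e : ∀ w, (t < w ∨ w < t) → posetGram S t w = 1 := by
      rintro w (hw | hw)
      · exact posetGram_of_lt hw
      · exact posetGram_of_gt hw
    calc (2 : ℝ) = ∑ u ∈ ({y, z} : Finset S), posetGram S t u := by
          rw [Finset.sum_pair hyz, e y hty, e z htz]; norm_num
      _ ≤ _ := Finset.sum_le_sum_of_subset_of_nonneg
          (by intro w hw; simp only [Finset.mem_insert, Finset.mem_singleton] at hw
              rcases hw with rfl | rfl <;> assumption)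
          (fun u _ _ => posetGram_nonneg t u)
  have self : ∀ (X : Finset S) (t : S), t ∈ X → (∀ u ∈ X, t ≤ u ∨ u ≤ t → u = t) →
      ∑ u ∈ X, posetGram S t u = 2 := by
    intro X t ht hX
    rw [Finset.sum_eq_single_of_mem t ht, posetGram_self]
    intro u hu hut
    exact posetGram_of_incomp (fun e => hut (hX u hu (Or.inl e)))
      (fun e => hut (hX u hu (Or.inr e)))
  have hA : ∀ t ∈ A, (posetGram S *ᵥ h) t ≤ 0 := by
    intro t ht
    have ht' := memA.mp ht
    obtain ⟨y, z, hy, hz, hyz⟩ := hcon t (Or.inl ht')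
    have hy' : IsMax y ∧ t < y := by
      rcases hy with h | h
      · exact h.2
      · exact absurd h.2.2 ht'.not_lt
    have hz' : IsMax z ∧ t < z := by
      rcases hz with h | h
      · exact h.2
      · exact absurd h.2.2 ht'.not_lt
    rw [hval, self A t ht (by
      rintro u hu (e | e)
      · exact ((memA.mp hu).eq_of_le e).symm
      · exact ht'.eq_of_le e)]
    linarith [two B t y z (memB.mpr hy'.1) (memB.mpr hz'.1) hyz (Or.inl hy'.2) (Or.inl hz'.2)]
  have hB : ∀ t ∈ B, 0 ≤ (posetGram S *ᵥ h) t := by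
    intro t ht
    have ht' := memB.mp ht
    obtain ⟨y, z, hy, hz, hyz⟩ := hcon t (Or.inr ht')
    have hy' : IsMin y ∧ y < t := by
      rcases hy with h | h
      · exact absurd h.2.2 ht'.not_lt
      · exact ⟨h.1, h.2.2⟩
    have hz' : IsMin z ∧ z < t := by
      rcases hz with h | h
      · exact absurd h.2.2 ht'.not_lt
      · exact ⟨h.1, h.2.2⟩
    rw [hval, self B t ht (by
      rintro u hu (e | e)
      · exact (ht'.eq_of_le e).symm
      · exact (memB.mp hu).eq_of_le e)]
    linarith [two A t y z (memA.mpr hy'.1) (memA.mpr hz'.1) hyz (Or.inr hy'.2) (Or.inr hz'.2)]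
  have hQ : h ⬝ᵥ posetGram S *ᵥ h ≤ 0 := by
    nth_rewrite 1 [hh]
    rw [sub_dotProduct, indicator_dotProduct, indicator_dotProduct]
    linarith [Finset.sum_nonpos hA, Finset.sum_nonneg hB]
  obtain ⟨a, ha, -⟩ := exists_isMin_le (Classical.arbitrary S)
  have h0 : h ≠ 0 := by
    intro e
    have := congrFun e a
    obtain ⟨y, z, hy, -, -⟩ := hcon a (Or.inl ha)
    have haB : a ∉ B := by
      intro hm
      rcases hy with h | h
      · exact (memB.mp hm).not_lt h.2.2
      · exact ha.not_lt h.2.2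
    simp [hh, memA.mpr ha, haB] at this
  exact absurd (hK h h0) (not_lt.mpr hQ)

omit [Fintype S] in
lemma forall_of_comparable_closed (hconn : (SimpleGraph.hasse S).Connected) {D : S → Prop}
    {x : S} (hx : D x) (hD : ∀ z u, D z → (z ≤ u ∨ u ≤ z) → D u) (z : S) : D z := by
  obtain ⟨p⟩ := hconn.preconnected x z
  induction p with
  | nil => exact hx
  | cons hadj p ih =>
    apply ih
    rw [SimpleGraph.hasse_adj] at hadj
    refine hD _ _ hx ?_
    rcases hadj with h | h
    · exact Or.inl h.le
    · exact Or.inr h.le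

/-- The path starting at an end of the extremal graph contains every extremal element, and any
comparable pair lies between a minimal and a maximal element that are adjacent on it. The chain
alternative covers paths with at most one edge. -/
theorem exists_zigzagCover (hconn : (SimpleGraph.hasse S).Connected)
    (hK : ∀ h : S → ℝ, h ≠ 0 → 0 < h ⬝ᵥ posetGram S *ᵥ h)
    (hN : ∀ h : S → ℝ, h ≠ 0 → (∀ s, 0 ≤ (posetGram S *ᵥ h) s) → 0 < ∑ s, h s) :
    (∀ s t : S, s ≤ t ∨ t ≤ s) ∨ ∃ v W r, 2 ≤ r ∧ ZigzagCover (S := S) v W r := by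
  classical
  have := hconn.nonempty
  obtain ⟨x, hxext, hx⟩ := exists_extremal_end hK
  obtain ⟨r, v, hv0, hinj, hadj, hclosed, hchord⟩ :=
    (extremalGraph S).exists_path_enumeration (extremalGraph_degree_le_two hK hN) x hx
  have himg : ∀ a b : S, IsMin a → IsMax b → a ≤ b →
      ((∃ i ≤ r, a = v i) ↔ ∃ j ≤ r, b = v j) := by
    intro a b ha hb hab
    rcases eq_or_lt_of_le hab with rfl | hlt
    · rfl
    constructor
    · rintro ⟨i, hi, rfl⟩
      exact hclosed i hi b (Or.inl ⟨ha, hb, hlt⟩)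
    · rintro ⟨i, hi, rfl⟩
      exact hclosed i hi a (Or.inr ⟨ha, hb, hlt⟩)
  -- Lying above a minimal element of the path is propagated along comparabilities by `himg`, hence
  -- holds throughout the connected poset.
  have hall : ∀ z : S, ∃ a b, IsMin a ∧ IsMax b ∧ a ≤ z ∧ z ≤ b ∧ ∃ i ≤ r, a = v i := by
    refine forall_of_comparable_closed hconn (x := x) ?_ ?_
    · rcases hxext with h | h
      · obtain ⟨b, hb, hxb⟩ := exists_isMax_ge x
        exact ⟨x, b, h, hb, le_rfl, hxb, 0, by omega, hv0.symm⟩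
      · obtain ⟨a, ha, hax⟩ := exists_isMin_le x
        exact ⟨a, x, ha, h, hax, le_rfl, (himg a x ha h hax).mpr ⟨0, by omega, hv0.symm⟩⟩
    · rintro z u ⟨a, b, ha, hb, haz, hzb, hi⟩ (h | h)
      · obtain ⟨b', hb', hub⟩ := exists_isMax_ge u
        exact ⟨a, b', ha, hb', haz.trans h, hub, hi⟩
      · obtain ⟨a', ha', hau⟩ := exists_isMin_le u
        refine ⟨a', b, ha', hb, hau, h.trans hzb, ?_⟩
        rw [himg a' b ha' hb (hau.trans (h.trans hzb)), ← himg a b ha hb (haz.trans hzb)]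
        exact hi
  have hmem : ∀ a, IsMin a ∨ IsMax a → ∃ i ≤ r, a = v i := by
    intro a ha
    obtain ⟨a', b', ha', hb', haa, hab, i, hi, rfl⟩ := hall a
    rcases ha with h | h
    · exact ⟨i, hi, (h.eq_of_le haa).symm⟩
    · have := h.eq_of_le hab
      exact (himg _ _ ha' h haa).mp ⟨i, hi, rfl⟩
  rcases Nat.eq_zero_or_pos r with hr0 | hrpos
  · left
    have hs : ∀ s : S, s = v 0 := by
      intro s
      obtain ⟨a, ha, has⟩ := exists_isMin_le s
      obtain ⟨b, hb, hsb⟩ := exists_isMax_ge s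
      obtain ⟨i, hi, rfl⟩ := hmem a (Or.inl ha)
      obtain ⟨j, hj, rfl⟩ := hmem b (Or.inr hb)
      rw [show i = 0 by omega] at has
      rw [show j = 0 by omega] at hsb
      exact le_antisymm hsb has
    intro s t
    left
    rw [hs s, hs t]
  have hext : ∀ i < r, (IsMin (v i) ∧ IsMax (v (i + 1)) ∧ v i < v (i + 1)) ∨
      (IsMax (v i) ∧ IsMin (v (i + 1)) ∧ v (i + 1) < v i) := by
    intro i hi
    rcases hadj i hi with h | h
    · exact Or.inl h
    · exact Or.inr ⟨h.2.1, h.1, h.2.2⟩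
  have hboth : ∀ i ≤ r, IsMin (v i) → IsMax (v i) → False := by
    intro i hi h1 h2
    rcases Nat.lt_or_eq_of_le hi with hi | rfl
    · rcases hext i hi with h | h
      · exact h2.not_lt h.2.2
      · exact h1.not_lt h.2.2
    · have := hext (i - 1) (by omega)
      rw [Nat.sub_add_cancel hrpos] at this
      rcases this with h | h
      · exact h1.not_lt h.2.2
      · exact h2.not_lt h.2.2
  have hnext : ∀ i ≤ r, ∀ j ≤ r, IsMin (v i) → IsMax (v j) → v i ≤ v j → i + 1 = j ∨ j + 1 = i := by
    intro i hi j hj h1 h2 hle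
    refine hchord i hi j hj (Or.inl ⟨h1, h2, lt_of_le_of_ne hle ?_⟩)
    intro e
    exact hboth i hi h1 (e ▸ h2)
  set W : ℕ → Finset S := fun i => if i < r then univ.filter (fun z =>
    (v i ≤ z ∧ z ≤ v (i + 1)) ∨ (v (i + 1) ≤ z ∧ z ≤ v i)) else ∅ with hW
  have memW : ∀ {z i}, z ∈ W i ↔ i < r ∧ ((v i ≤ z ∧ z ≤ v (i + 1)) ∨ (v (i + 1) ≤ z ∧ z ≤ v i)) := by
    intro z i
    by_cases hi : i < r <;> simp [hW, hi]
  -- the minimal and the maximal end of a chain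
  have ends : ∀ z i, z ∈ W i → i < r ∧ ∃ p q, p + q = 2 * i + 1 ∧ (p = i ∨ p = i + 1) ∧
      IsMin (v p) ∧ IsMax (v q) ∧ v p ≤ z ∧ z ≤ v q := by
    intro z i hz
    obtain ⟨hi, hz⟩ := memW.mp hz
    refine ⟨hi, ?_⟩
    rcases hext i hi with h | h
    · refine ⟨i, i + 1, by omega, Or.inl rfl, h.1, h.2.1, ?_⟩
      rcases hz with hz | hz
      · exact hz
      · exact absurd (hz.1.trans hz.2) h.2.2.not_ge
    · refine ⟨i + 1, i, by omega, Or.inr rfl, h.2.1, h.1, ?_⟩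
      rcases hz with hz | hz
      · exact absurd (hz.1.trans hz.2) h.2.2.not_ge
      · exact hz
  have common : ∀ z u, z ≤ u → ∃ i, z ∈ W i ∧ u ∈ W i := by
    intro z u hzu
    obtain ⟨a, ha, haz⟩ := exists_isMin_le z
    obtain ⟨b, hb, hub⟩ := exists_isMax_ge u
    obtain ⟨i, hi, rfl⟩ := hmem a (Or.inl ha)
    obtain ⟨j, hj, rfl⟩ := hmem b (Or.inr hb)
    rcases hnext i hi j hj ha hb (haz.trans (hzu.trans hub)) with h | h
    · subst h
      exact ⟨i, memW.mpr ⟨by omega, Or.inl ⟨haz, hzu.trans hub⟩⟩,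
        memW.mpr ⟨by omega, Or.inl ⟨haz.trans hzu, hub⟩⟩⟩
    · subst h
      exact ⟨j, memW.mpr ⟨by omega, Or.inr ⟨haz, hzu.trans hub⟩⟩,
        memW.mpr ⟨by omega, Or.inr ⟨haz.trans hzu, hub⟩⟩⟩
  have hcomp : ∀ z u, (z ≤ u ∨ u ≤ z) ↔ ∃ i, z ∈ W i ∧ u ∈ W i := by
    intro z u
    constructor
    · rintro (h | h)
      · exact common z u h
      · obtain ⟨i, h1, h2⟩ := common u z h
        exact ⟨i, h2, h1⟩
    · rintro ⟨i, hz, hu⟩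
      obtain ⟨hi, p, q, hpq, hp, hmin, hmax, h1, h2⟩ := ends z i hz
      obtain ⟨-, p', q', hpq', hp', hmin', hmax', h1', h2'⟩ := ends u i hu
      have hpp : p = p' := by
        rcases hp with hp | hp <;> rcases hp' with hp' | hp'
        · omega
        · have : p' = q := by omega
          subst this
          exact absurd hmax (hboth _ (by omega) hmin')
        · have : p = q' := by omega
          subst this
          exact absurd hmax' (hboth _ (by omega) hmin)
        · omega
      subst hpp
      have hqq : q = q' := by omega
      subst hqq
      exact comparable_of_between hK hN hmin hmax h1 h1' h2 h2'
  have hcover : ∀ z, ∃ i, z ∈ W i := by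
    intro z
    obtain ⟨i, h, -⟩ := common z z le_rfl
    exact ⟨i, h⟩
  rcases Nat.lt_or_ge r 2 with hr2 | hr2
  · left
    intro s t
    obtain ⟨i, hs⟩ := hcover s
    obtain ⟨j, ht⟩ := hcover t
    have hi := (memW.mp hs).1
    have hj := (memW.mp ht).1
    rw [hcomp]
    exact ⟨i, hs, by rwa [show i = j by omega]⟩
  · right
    refine ⟨v, W, r, hr2, ?_, ?_, ?_, hcover, ?_, hcomp, hinj, ?_⟩
    · intro i hi
      refine memW.mpr ⟨hi, ?_⟩
      rcases hext i hi with h | h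
      · exact Or.inl ⟨le_rfl, h.2.2.le⟩
      · exact Or.inr ⟨h.2.2.le, le_rfl⟩
    · intro i hi
      refine memW.mpr ⟨hi, ?_⟩
      rcases hext i hi with h | h
      · exact Or.inl ⟨h.2.2.le, le_rfl⟩
      · exact Or.inr ⟨le_rfl, h.2.2.le⟩
    · intro i hi
      simp [hW, not_lt.mpr hi]
    · intro z i j hzi hzj hij
      obtain ⟨hi, p, q, hpq, hp, hmin, hmax, h1, h2⟩ := ends z i hzi
      obtain ⟨hj, p', q', hpq', hp', hmin', hmax', h1', h2'⟩ := ends z j hzj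
      -- A common element puts the minimal end of each chain below the maximal end of the other, so
      -- these ends are neighbours on the path; index arithmetic leaves j = i + 1.
      have e1 := hnext p (by omega) q' (by omega) hmin hmax' (h1.trans h2')
      have e2 := hnext p' (by omega) q (by omega) hmin' hmax (h1'.trans h2)
      omega
    · intro i hi
      rcases hext i hi with h | h
      · exact Or.inl ⟨h.1, h.2.1⟩
      · exact Or.inr ⟨h.1, h.2.1⟩

end Zigzag

/-! ### Arithmetic of legs and masses -/

/-- The total number `∑_{t < i} (k t + 1)`. -/
def legSize (k : ℕ → ℕ) (i : ℕ) : ℕ := ∑ t ∈ range i, (k t + 1)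

lemma legSize_succ (k : ℕ → ℕ) (i : ℕ) : legSize k (i + 1) = legSize k i + (k i + 1) :=
  Finset.sum_range_succ _ _

lemma legSize_zero (k : ℕ → ℕ) : legSize k 0 = 0 := Finset.sum_range_zero _

lemma two_le_legSize {k : ℕ → ℕ} (hk : 1 ≤ k 0) {i : ℕ} (hi : 0 < i) : 2 ≤ legSize k i := by
  obtain ⟨j, rfl⟩ : ∃ j, i = j + 1 := ⟨i - 1, by omega⟩
  induction j with
  | zero => simp [legSize_succ, legSize_zero]; omega
  | succ j ih =>
    rw [legSize_succ]
    have := ih (by omega)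
    omega

lemma half_lt_of_total {k : ℕ} {w s : ℝ} (hs : 0 < s) (htot : (k + 1) * w = k + s) (hk : 1 ≤ k) :
    1 / 2 < w := by
  have hk' : (1 : ℝ) ≤ k := by exact_mod_cast hk
  nlinarith

/-- The masses along a leg all of whose links are single elements. -/
lemma leg_mass {k : ℕ → ℕ} {g w : ℕ → ℝ} {l : ℕ} (hg0 : g 0 = 0)
    (hg : ∀ i, 0 < i → i ≤ l → 0 < g i)
    (htot : ∀ i < l, ((k i : ℝ) + 1) * w i = k i + (g i + g (i + 1)))
    (hlink : ∀ i, i + 1 < l → w i + w (i + 1) = 1)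
    (hk : 1 ≤ k 0) (i : ℕ) (hi : i < l) :
    ∃ q : ℕ, (legSize k (i + 1) : ℝ) * w i = q + g (i + 1) ∧ 1 ≤ q ∧ q < legSize k (i + 1) ∧
      ((1 / 2 < w i ∧ legSize k (i + 1) ≤ 2 * q) ∨
        (w i < 1 / 2 ∧ 2 * q < legSize k (i + 1) ∧ k i = 0)) := by
  induction i with
  | zero =>
    have h := htot 0 hi
    rw [hg0, zero_add] at h
    refine ⟨k 0, ?_, hk, ?_, Or.inl ⟨?_, ?_⟩⟩
    · rw [legSize_succ, legSize_zero]
      push_cast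
      linarith
    · rw [legSize_succ, legSize_zero]; omega
    · exact half_lt_of_total (hg 1 one_pos hi) h hk
    · rw [legSize_succ, legSize_zero]; omega
  | succ i ih =>
    obtain ⟨q, hq, hq1, hqN, hcase⟩ := ih (by omega)
    have h := htot (i + 1) hi
    have hl := hlink i hi
    have hpos : 0 < g (i + 1) + g (i + 1 + 1) :=
      add_pos (hg _ (by omega) (by omega)) (hg _ (by omega) (by omega))
    -- The new q comes from substituting w i = 1 - w (i + 1) into the old relation and adding it to
    -- the mass equation of the next chain. It exchanges heavy and light.
    refine ⟨k (i + 1) + legSize k (i + 1) - q, ?_, by omega, ?_, ?_⟩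
    · rw [legSize_succ k (i + 1), Nat.cast_sub (by omega)]
      push_cast
      have hw : w i = 1 - w (i + 1) := by linarith
      rw [hw] at hq
      linarith
    · rw [legSize_succ k (i + 1)]; omega
    · rw [legSize_succ k (i + 1)]
      rcases hcase with ⟨h1, h2⟩ | ⟨h1, h2, h3⟩
      · right
        have hk0 : k (i + 1) = 0 := by
          by_contra hne
          have := half_lt_of_total hpos h (by omega)
          linarith
        exact ⟨by linarith, by omega, hk0⟩
      · left
        exact ⟨by linarith, by omega⟩

/-- Two legs, one with heavy and one with light first chain, cannot meet in a branching link. -/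
lemma false_of_heavy_light {N q N' q' n : ℕ} {g w w' : ℝ} (hg : 0 < g) (hn : 2 ≤ n)
    (hw : (N : ℝ) * w = q + g) (hw' : (N' : ℝ) * w' = q' + g) (hsum : w + w' = 1 + g - g / n)
    (hpd : 1 - 1 / (n : ℝ) < 1 / N + 1 / N') (hq : 1 ≤ q) (hqN : q < N) (hheavy : N ≤ 2 * q)
    (hq' : 1 ≤ q') (hlight : 2 * q' < N') (hw'2 : w' < 1 / 2) (hgw' : g < w') : False := by
  have hn' : (2 : ℝ) ≤ n := by exact_mod_cast hn
  have hN2 : 2 ≤ N := by omega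
  have hN3 : 3 ≤ N' := by omega
  -- For N, N' ≥ 3 the Dynkin inequality forces n = 2 and N, N' < 6, a finite check. For N = 2 one
  -- gets w = (1 + g)/2, hence w' ≥ 1/2.
  rcases Nat.lt_or_eq_of_le hN2 with hN | rfl
  · have i1 : 1 / (N : ℝ) ≤ 1 / 3 :=
      one_div_le_one_div_of_le (by norm_num) (by exact_mod_cast hN)
    have i2 : 1 / (N' : ℝ) ≤ 1 / 3 :=
      one_div_le_one_div_of_le (by norm_num) (by exact_mod_cast hN3)
    have hn2 : n = 2 := by
      by_contra hne
      have : 1 / (n : ℝ) ≤ 1 / 3 :=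
        one_div_le_one_div_of_le (by norm_num) (by exact_mod_cast (by omega : 3 ≤ n))
      linarith
    subst hn2
    push_cast at hsum hpd
    have hN6 : N < 6 := by
      by_contra hcon
      have : 1 / (N : ℝ) ≤ 1 / 6 :=
        one_div_le_one_div_of_le (by norm_num) (by exact_mod_cast not_lt.mp hcon)
      linarith
    have hN6' : N' < 6 := by
      by_contra hcon
      have : 1 / (N' : ℝ) ≤ 1 / 6 :=
        one_div_le_one_div_of_le (by norm_num) (by exact_mod_cast not_lt.mp hcon)
      linarith
    have hq2 : q' ≤ 2 := by omega
    interval_cases N <;> interval_cases N' <;> norm_num at hpd <;> interval_cases q <;>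
      interval_cases q' <;> norm_num at hw hw' <;> first | omega | linarith
  · have hq1 : q = 1 := by omega
    subst hq1
    push_cast at hw
    have : g / n ≤ g / 2 := div_le_div_of_nonneg_left hg.le (by norm_num) hn'
    linarith

/-- Numerical data of a zigzag of chains: `k i` is the number of elements lying only in the `i`-th
chain, `n i` and `g i` are the size and the mass of the link between the chains `i - 1` and `i`, and
`w i` is the mass of the `i`-th chain. -/
structure ChainData (m : ℕ) (k n : ℕ → ℕ) (g w : ℕ → ℝ) : Prop where
  g_zero : g 0 = 0
  g_last : g m = 0
  g_pos : ∀ i, 0 < i → i < m → 0 < g i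
  n_pos : ∀ i, 0 < i → i < m → 1 ≤ n i
  total : ∀ i < m, ((k i : ℝ) + 1) * w i = k i + (g i + g (i + 1))
  link : ∀ i, i + 1 < m → w i + w (i + 1) = 1 + g (i + 1) - g (i + 1) / n (i + 1)
  k_first : 1 ≤ k 0
  k_last : 1 ≤ k (m - 1)

lemma ChainData.half_lt {m : ℕ} {k n : ℕ → ℕ} {g w : ℕ → ℝ} (h : ChainData m k n g w)
    (hm : 2 ≤ m) {i : ℕ} (hi : i < m) (hk : 1 ≤ k i) : 1 / 2 < w i := by
  refine half_lt_of_total ?_ (h.total i hi) hk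
  rcases Nat.eq_zero_or_pos i with rfl | hpos
  · rw [h.g_zero, zero_add]
    exact h.g_pos 1 one_pos (by omega)
  · have h1 := h.g_pos i hpos hi
    rcases Nat.lt_or_eq_of_le (Nat.succ_le_of_lt hi) with h2 | h2
    · exact add_pos h1 (h.g_pos (i + 1) (by omega) h2)
    · have : g (i + 1) = 0 := by
        have := h.g_last
        rwa [← h2] at this
      linarith

/-- Two links of size at least 2 violate `hpd'`, as each costs at least 1/2 and each leg contributes
at most 1/2. Around a single such link the chains on both sides end unbranched legs, so `leg_mass`
classifies each as heavy (mass above 1/2) or light; every combination contradicts the link equation.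
-/
lemma ChainData.link_size_eq_one {m : ℕ} {k n : ℕ → ℕ} {g w : ℕ → ℝ} (h : ChainData m k n g w)
    (hpd : ∀ l, 0 < l → l < m → 1 - 1 / (n l : ℝ) <
      1 / legSize k l + 1 / legSize (fun t => k (m - 1 - t)) (m - l))
    (hpd' : ∀ l l', 0 < l → l < l' → l' < m → (1 - 1 / (n l : ℝ)) + (1 - 1 / (n l' : ℝ)) <
      1 / legSize k l + 1 / legSize (fun t => k (m - 1 - t)) (m - l')) :
    ∀ l, 0 < l → l < m → n l = 1 := by
  have klast : 1 ≤ (fun t => k (m - 1 - t)) 0 := h.k_last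
  have half : ∀ j, 0 < j → j < m → n j ≠ 1 → (1 : ℝ) / 2 ≤ 1 - 1 / n j := by
    intro j h0 hj hne
    have := h.n_pos j h0 hj
    have : 1 / (n j : ℝ) ≤ 1 / 2 :=
      one_div_le_one_div_of_le (by norm_num) (by exact_mod_cast (by omega : 2 ≤ n j))
    linarith
  have small : ∀ (k : ℕ → ℕ) (j : ℕ), 1 ≤ k 0 → 0 < j → 1 / (legSize k j : ℝ) ≤ 1 / 2 := by
    intro k j hk hj
    exact one_div_le_one_div_of_le (by norm_num) (by exact_mod_cast two_le_legSize hk hj)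
  have two : ∀ i j, 0 < i → i < j → j < m → n i ≠ 1 → n j ≠ 1 → False := by
    intro i j hi hij hj h1 h2
    have := hpd' i j hi hij hj
    linarith [half i hi (by omega) h1, half j (by omega) hj h2, small k i h.k_first hi,
      small (fun t => k (m - 1 - t)) (m - j) klast (by omega)]
  intro l hl0 hl
  by_contra hne
  have others : ∀ j, 0 < j → j < m → j ≠ l → n j = 1 := by
    intro j hj0 hj hjl
    by_contra hne'
    rcases Nat.lt_or_gt_of_ne hjl with hlt | hlt
    · exact two j l hj0 hlt hl hne' hne
    · exact two l j hl0 hlt hj hne hne'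
  have hn2 : 2 ≤ n l := by have := h.n_pos l hl0 hl; omega
  have hlink : ∀ i, i + 1 < m → i + 1 ≠ l → w i + w (i + 1) = 1 := by
    intro i hi hil
    have := h.link i hi
    rw [others (i + 1) (by omega) hi hil] at this
    push_cast at this
    linarith
  have hl1 : l - 1 + 1 = l := by omega
  have hr1 : m - l - 1 + 1 = m - l := by omega
  have hg := h.g_pos l hl0 hl
  obtain ⟨q, e1, e2, e3, e4⟩ := leg_mass (l := l) h.g_zero
    (fun i hi0 hi => h.g_pos i hi0 (by omega)) (fun i hi => h.total i (by omega))
    (fun i hi => hlink i (by omega) (by omega)) h.k_first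
    (l - 1) (by omega)
  obtain ⟨q', f1, f2, f3, f4⟩ := leg_mass (k := fun t => k (m - 1 - t)) (g := fun t => g (m - t))
    (w := fun t => w (m - 1 - t)) (l := m - l) h.g_last
    (fun i hi0 hi => h.g_pos (m - i) (by omega) (by omega))
    (fun i hi => by
      have := h.total (m - 1 - i) (by omega)
      rw [show m - 1 - i + 1 = m - i by omega] at this
      rw [show m - (i + 1) = m - 1 - i by omega]
      linarith)
    (fun i hi => by
      have := hlink (m - 1 - (i + 1)) (by omega) (by omega)
      rw [show m - 1 - (i + 1) + 1 = m - 1 - i by omega] at this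
      linarith)
    klast (m - l - 1) (by omega)
  simp only [hl1, hr1, show m - 1 - (m - l - 1) = l by omega,
    show m - (m - l) = l by omega] at e1 e3 e4 f1 f3 f4
  have hs := h.link (l - 1) (by omega)
  rw [hl1] at hs
  have hpdl := hpd l hl0 hl
  set N := legSize k l
  set N' := legSize (fun t => k (m - 1 - t)) (m - l)
  have hN : (0 : ℝ) < N := by exact_mod_cast (by omega : 0 < N)
  have hN' : (0 : ℝ) < N' := by exact_mod_cast (by omega : 0 < N')
  rcases e4 with ⟨e4, e5⟩ | ⟨e4, e5, e6⟩ <;> rcases f4 with ⟨f4, f5⟩ | ⟨f4, f5, f6⟩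
  -- Both heavy: the masses add up to at least 1 + g(1/N + 1/N') > 1 + g - g/n.
  · have a1 : w (l - 1) ≥ 1 / 2 + g l * (1 / N) := by
      have : (N : ℝ) ≤ 2 * q := by exact_mod_cast e5
      rw [ge_iff_le, ← mul_le_mul_iff_right₀ hN, e1]
      field_simp
      linarith
    have a2 : w l ≥ 1 / 2 + g l * (1 / N') := by
      have : (N' : ℝ) ≤ 2 * q' := by exact_mod_cast f5
      rw [ge_iff_le, ← mul_le_mul_iff_right₀ hN', f1]
      field_simp
      linarith
    have a3 := mul_lt_mul_of_pos_left hpdl hg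
    have a4 : g l / n l = g l * (1 / n l) := by ring
    linarith
  -- Heavy and light: the light chain has no own elements, so its mass is the sum of its two link
  -- masses and exceeds g l.
  · have htot := h.total l hl
    rw [f6] at htot
    push_cast at htot
    refine false_of_heavy_light hg hn2 e1 f1 hs hpdl e2 e3 e5 f2 f5 f4 ?_
    have hlm : l + 1 < m := by
      by_contra hcon
      have := h.k_last
      rw [show m - 1 = l by omega] at this
      omega
    linarith [h.g_pos (l + 1) (by omega) hlm]
  · have htot := h.total (l - 1) (by omega)
    rw [e6, hl1] at htot
    push_cast at htot
    refine false_of_heavy_light hg hn2 f1 e1 (by linarith) (by linarith) f2 f3 f5 e2 e5 e4 ?_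
    have hlm : 0 < l - 1 := by
      by_contra hcon
      have := h.k_first
      rw [show 0 = l - 1 by omega] at this
      omega
    linarith [h.g_pos (l - 1) hlm (by omega)]
  -- Both light: the masses add up to less than 1, but the link equation gives at least 1.
  · have : g l / n l ≤ g l := div_le_self hg.le (by exact_mod_cast (by omega : 1 ≤ n l))
    linarith

/-- With single-point links w i + w (i + 1) = 1, so the masses alternate about 1/2 starting above
it. An own element forces mass above 1/2, so it can occur only at even indices; the last chain has
one, so m - 1 is even. -/
lemma ChainData.parity {m : ℕ} {k n : ℕ → ℕ} {g w : ℕ → ℝ} (h : ChainData m k n g w)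
    (hm : 2 ≤ m) (hn : ∀ l, 0 < l → l < m → n l = 1) :
    Odd m ∧ ∀ i < m, Odd i → k i = 0 := by
  have hw : ∀ i < m, (Even i → 1 / 2 < w i) ∧ (Odd i → w i < 1 / 2) := by
    intro i
    induction i with
    | zero => exact fun hi => ⟨fun _ => h.half_lt hm hi h.k_first, fun h => by simp at h⟩
    | succ i ih =>
      intro hi
      obtain ⟨h1, h2⟩ := ih (by omega)
      have hl := h.link i hi
      rw [hn (i + 1) (by omega) hi] at hl
      push_cast at hl
      constructor
      · intro he
        have := h2 (by simpa [Nat.even_add_one] using he)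
        linarith
      · intro ho
        have := h1 (by simpa [Nat.odd_add_one] using ho)
        linarith
  have hk : ∀ i < m, Odd i → k i = 0 := by
    intro i hi ho
    by_contra hne
    linarith [(hw i hi).2 ho, h.half_lt hm hi (by omega)]
  refine ⟨?_, hk⟩
  by_contra hcon
  rw [Nat.not_odd_iff_even] at hcon
  have := hk (m - 1) (by omega) (Nat.Even.sub_odd (by omega) hcon odd_one)
  have := h.k_last
  omega

/-! ### From the poset to chain data -/

section Masses

variable {S : Type*} [PartialOrder S] [DecidableEq S]

/-- The intersection of the chains `W (i - 1)` and `W i`, empty for `i = 0`. -/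
def chainLink (W : ℕ → Finset S) : ℕ → Finset S
  | 0 => ∅
  | i + 1 => W i ∩ W (i + 1)

/-- The elements of `W i` lying in no neighbouring chain. -/
def chainOwn (W : ℕ → Finset S) (i : ℕ) : Finset S :=
  W i \ (chainLink W i ∪ chainLink W (i + 1))

namespace ZigzagCover

variable {v : ℕ → S} {W : ℕ → Finset S} {r : ℕ}

omit [PartialOrder S] in
lemma link_subset (i : ℕ) : chainLink W i ⊆ W i := by
  cases i with
  | zero => simp [chainLink]
  | succ i => exact Finset.inter_subset_right

omit [PartialOrder S] in
lemma link_succ_subset (i : ℕ) : chainLink W (i + 1) ⊆ W i := Finset.inter_subset_left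

lemma disjoint_link (h : ZigzagCover v W r) (i : ℕ) :
    Disjoint (chainLink W i) (chainLink W (i + 1)) := by
  cases i with
  | zero => simp [chainLink]
  | succ i =>
    rw [Finset.disjoint_left]
    intro z hz hz'
    simp only [chainLink, Finset.mem_inter] at hz hz'
    have := h.consecutive z i (i + 1 + 1) hz.1 hz'.2 (by omega)
    omega

lemma sum_chain (h : ZigzagCover v W r) (f : S → ℝ) (i : ℕ) :
    ∑ z ∈ W i, f z =
      ∑ z ∈ chainOwn W i, f z + (∑ z ∈ chainLink W i, f z + ∑ z ∈ chainLink W (i + 1), f z) := by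
  rw [← Finset.sum_union (h.disjoint_link i), chainOwn, Finset.sum_sdiff]
  exact Finset.union_subset (link_subset i) (link_succ_subset i)

lemma eq_of_mem_own (h : ZigzagCover v W r) {z : S} {i j : ℕ} (hz : z ∈ chainOwn W i)
    (hj : z ∈ W j) : j = i := by
  simp only [chainOwn, Finset.mem_sdiff, Finset.mem_union, not_or] at hz
  obtain ⟨hi, h1, h2⟩ := hz
  rcases lt_trichotomy i j with hij | hij | hij
  · have := h.consecutive z i j hi hj hij
    subst this
    exact absurd (Finset.mem_inter.mpr ⟨hi, hj⟩) h2
  · exact hij.symm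
  · have := h.consecutive z j i hj hi hij
    subst this
    exact absurd (Finset.mem_inter.mpr ⟨hj, hi⟩) h1

lemma eq_or_eq_of_mem_link (h : ZigzagCover v W r) {z : S} {i j : ℕ}
    (hz : z ∈ chainLink W (i + 1)) (hj : z ∈ W j) : j = i ∨ j = i + 1 := by
  obtain ⟨h1, h2⟩ := Finset.mem_inter.mp hz
  rcases lt_trichotomy i j with hij | hij | hij
  · exact Or.inr (h.consecutive z i j h1 hj hij)
  · exact Or.inl hij.symm
  · have := h.consecutive z j (i + 1) hj h2 (by omega)
    omega

omit [PartialOrder S] in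
lemma mem_own_or_mem_link {z : S} {i : ℕ} (hz : z ∈ W i) :
    z ∈ chainOwn W i ∨ z ∈ chainLink W i ∨ z ∈ chainLink W (i + 1) := by
  simp only [chainOwn, Finset.mem_sdiff, Finset.mem_union]
  tauto

lemma endpoint_mem_link (h : ZigzagCover v W r) {i : ℕ} (h0 : 0 < i) (hi : i < r) :
    v i ∈ chainLink W i := by
  obtain ⟨j, rfl⟩ : ∃ j, i = j + 1 := ⟨i - 1, by omega⟩
  exact Finset.mem_inter.mpr ⟨h.right_mem j (by omega), h.left_mem _ hi⟩

lemma link_eq_empty (h : ZigzagCover v W r) : chainLink W r = ∅ := by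
  cases r with
  | zero => rfl
  | succ r => simp [chainLink, h.eq_empty (r + 1) le_rfl]

omit [DecidableEq S] in
/-- Endpoints at distance two are distinct extremal elements of the same kind. -/
lemma endpoint_not_comparable (h : ZigzagCover v W r) {i : ℕ} (hi : i + 1 < r) :
    ¬ (v i ≤ v (i + 1 + 1) ∨ v (i + 1 + 1) ≤ v i) := by
  intro hc
  have hne : v i ≠ v (i + 1 + 1) := fun e => by
    have := h.inj i (by omega) (i + 1 + 1) (by omega) e
    omega
  have hne1 : v i ≠ v (i + 1) := fun e => by
    have := h.inj i (by omega) (i + 1) (by omega) e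
    omega
  have hm : ∃ j, v i ∈ W j ∧ v (i + 1) ∈ W j :=
    ⟨i, h.left_mem i (by omega), h.right_mem i (by omega)⟩
  rcases h.extremal i (by omega) with h1 | h1 <;> rcases h.extremal (i + 1) hi with h2 | h2
  · have hz : IsMin (v (i + 1)) := h2.1
    exact hne1 (by
      rcases (h.comparable_iff _ _).mpr hm with e | e
      · exact (hz.eq_of_le e)
      · exact (h1.2.eq_of_le e).symm)
  · rcases hc with e | e
    · exact hne (h2.2.eq_of_le e)
    · exact hne (h1.1.eq_of_le e).symm
  · rcases hc with e | e
    · exact hne (h1.1.eq_of_le e)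
    · exact hne (h2.2.eq_of_le e).symm
  · have hz : IsMax (v (i + 1)) := h2.1
    exact hne1 (by
      rcases (h.comparable_iff _ _).mpr hm with e | e
      · exact (h1.2.eq_of_le e)
      · exact (hz.eq_of_le e).symm)

lemma first_mem_own (h : ZigzagCover v W r) (hr : 2 ≤ r) : v 0 ∈ chainOwn W 0 := by
  rcases mem_own_or_mem_link (h.left_mem 0 (by omega)) with h1 | h1 | h1
  · exact h1
  · simp [chainLink] at h1
  · exact absurd ((h.comparable_iff _ _).mpr
      ⟨1, (Finset.mem_inter.mp h1).2, h.right_mem 1 (by omega)⟩) (h.endpoint_not_comparable (by omega))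

lemma last_mem_own (h : ZigzagCover v W r) (hr : 2 ≤ r) : v r ∈ chainOwn W (r - 1) := by
  obtain ⟨i, rfl⟩ : ∃ i, r = i + 1 + 1 := ⟨r - 2, by omega⟩
  have hmem := h.right_mem (i + 1) (by omega)
  rcases mem_own_or_mem_link hmem with h1 | h1 | h1
  · exact h1
  · exact absurd ((h.comparable_iff _ _).mpr
      ⟨i, h.left_mem i (by omega), (Finset.mem_inter.mp h1).1⟩) (h.endpoint_not_comparable (by omega))
  · rw [h.link_eq_empty] at h1
    simp at h1

variable [Fintype S]

/-- Each element is counted at the first chain containing it, so a link belongs to its left chain.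
-/
lemma sum_eq (h : ZigzagCover v W r) (f : S → ℝ) :
    ∑ z, f z = ∑ i ∈ range r, (∑ z ∈ chainOwn W i, f z + ∑ z ∈ chainLink W (i + 1), f z) := by
  classical
  have hlt : ∀ z, Nat.find (h.cover z) < r := fun z => h.lt_of_mem (Nat.find_spec (h.cover z))
  rw [← Finset.sum_fiberwise_of_maps_to (s := univ) (t := range r)
    (g := fun z => Nat.find (h.cover z)) (fun z _ => Finset.mem_range.mpr (hlt z)) f]
  refine Finset.sum_congr rfl fun i _ => ?_
  have hdisj : Disjoint (chainOwn W i) (chainLink W (i + 1)) := by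
    rw [Finset.disjoint_left]
    intro z hz hz'
    simp only [chainOwn, Finset.mem_sdiff, Finset.mem_union, not_or] at hz
    exact hz.2.2 hz'
  rw [← Finset.sum_union hdisj]
  congr 1
  ext z
  simp only [Finset.mem_filter, Finset.mem_univ, true_and, Finset.mem_union]
  constructor
  · rintro rfl
    rcases mem_own_or_mem_link (Nat.find_spec (h.cover z)) with h1 | h1 | h1
    · exact Or.inl h1
    · exfalso
      obtain ⟨j, hj⟩ | hj : (∃ j, Nat.find (h.cover z) = j + 1) ∨ Nat.find (h.cover z) = 0 := by
        rcases Nat.eq_zero_or_pos (Nat.find (h.cover z)) with e | e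
        · exact Or.inr e
        · exact Or.inl ⟨_, (Nat.sub_add_cancel e).symm⟩
      · rw [hj] at h1
        exact Nat.find_min (h.cover z) (m := j) (by omega) (Finset.mem_inter.mp h1).1
      · rw [hj] at h1
        simp [chainLink] at h1
    · exact Or.inr h1
  · rintro (h1 | h1)
    · exact h.eq_of_mem_own h1 (Nat.find_spec (h.cover z))
    · refine (Nat.find_eq_iff _).mpr ⟨(Finset.mem_inter.mp h1).1, fun j hj hz => ?_⟩
      rcases h.eq_or_eq_of_mem_link h1 hz with e | e <;> omega

/-- M is the identity plus the reflexive comparability matrix. -/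
lemma mulVec_eq {x : S → ℝ} {z : S} {F : Finset S} (hF : ∀ u, u ∈ F ↔ (z ≤ u ∨ u ≤ z)) :
    (posetGram S *ᵥ x) z = x z + ∑ u ∈ F, x u := by
  classical
  have h1 : ∀ u, posetGram S z u = (if u = z then 1 else 0) + (if u ∈ F then 1 else 0) := by
    intro u
    by_cases huz : u = z
    · subst huz
      rw [posetGram_self, if_pos rfl, if_pos ((hF u).mpr (Or.inl le_rfl))]
      norm_num
    · by_cases hu : u ∈ F
      · rw [posetGram_of_comparable (Ne.symm huz) ((hF u).mp hu), if_neg huz, if_pos hu, zero_add]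
      · have := mt (hF u).mpr hu
        push Not at this
        rw [posetGram_of_incomp this.1 this.2, if_neg huz, if_neg hu, zero_add]
  simp only [mulVec, dotProduct, h1, add_mul, ite_mul, one_mul, zero_mul,
    Finset.sum_add_distrib, Finset.sum_ite_eq', Finset.mem_univ, if_true]
  congr 1
  rw [← Finset.sum_filter]
  congr 1
  ext u
  simp

lemma mulVec_own (h : ZigzagCover v W r) (x : S → ℝ) {z : S} {i : ℕ} (hz : z ∈ chainOwn W i) :
    (posetGram S *ᵥ x) z = x z + ∑ u ∈ W i, x u := by
  refine mulVec_eq fun u => ?_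
  rw [h.comparable_iff]
  constructor
  · exact fun hu => ⟨i, (Finset.mem_sdiff.mp hz).1, hu⟩
  · rintro ⟨j, hzj, hu⟩
    rwa [← h.eq_of_mem_own hz hzj]

lemma mulVec_link (h : ZigzagCover v W r) (x : S → ℝ) {z : S} {i : ℕ}
    (hz : z ∈ chainLink W (i + 1)) :
    (posetGram S *ᵥ x) z =
      x z + (∑ u ∈ W i, x u + ∑ u ∈ W (i + 1), x u - ∑ u ∈ chainLink W (i + 1), x u) := by
  have : ∑ u ∈ W i ∪ W (i + 1), x u =
      ∑ u ∈ W i, x u + ∑ u ∈ W (i + 1), x u - ∑ u ∈ chainLink W (i + 1), x u := by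
    have := Finset.sum_union_inter (s₁ := W i) (s₂ := W (i + 1)) (f := x)
    simp only [chainLink]
    linarith
  rw [← this]
  refine mulVec_eq fun u => ?_
  rw [h.comparable_iff, Finset.mem_union]
  obtain ⟨h1, h2⟩ := Finset.mem_inter.mp hz
  constructor
  · rintro (hu | hu)
    · exact ⟨i, h1, hu⟩
    · exact ⟨i + 1, h2, hu⟩
  · rintro ⟨j, hzj, hu⟩
    rcases h.eq_or_eq_of_mem_link hz hzj with rfl | rfl
    · exact Or.inl hu
    · exact Or.inr hu

omit [Fintype S] in
lemma link_card_pos (h : ZigzagCover v W r) {i : ℕ} (h0 : 0 < i) (hi : i < r) :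
    0 < (chainLink W i).card := Finset.card_pos.mpr ⟨_, h.endpoint_mem_link h0 hi⟩

/-- The equations My = 1 make y constant on own parts, with value 1 - w i, and on links, with value
g i / n i; summing gives the relations. The endpoints v 0 and v r are own elements of the outer
chains. -/
lemma chainData (h : ZigzagCover v W r) (hr : 2 ≤ r) {y : S → ℝ} (hy : ∀ s, 0 < y s)
    (hM : ∀ s, (posetGram S *ᵥ y) s = 1) :
    ChainData r (fun i => (chainOwn W i).card) (fun i => (chainLink W i).card)
      (fun i => ∑ z ∈ chainLink W i, y z) (fun i => ∑ z ∈ W i, y z) where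
  g_zero := by simp [chainLink]
  g_last := by simp [h.link_eq_empty]
  g_pos i h0 hi := Finset.sum_pos (fun z _ => hy z) ⟨_, h.endpoint_mem_link h0 hi⟩
  n_pos i h0 hi := h.link_card_pos h0 hi
  total i hi := by
    have h1 : ∑ z ∈ chainOwn W i, y z = ∑ z ∈ chainOwn W i, (1 - ∑ u ∈ W i, y u) := by
      refine Finset.sum_congr rfl fun z hz => ?_
      have := h.mulVec_own y hz
      rw [hM] at this
      linarith
    rw [Finset.sum_const, nsmul_eq_mul] at h1
    have h2 := h.sum_chain y i
    rw [h1] at h2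
    linarith
  link i hi := by
    have hn : (0 : ℝ) < (chainLink W (i + 1)).card := by
      exact_mod_cast h.link_card_pos (by omega) hi
    have h1 : ∑ z ∈ chainLink W (i + 1), y z = ∑ z ∈ chainLink W (i + 1),
        (1 - (∑ u ∈ W i, y u + ∑ u ∈ W (i + 1), y u - ∑ u ∈ chainLink W (i + 1), y u)) := by
      refine Finset.sum_congr rfl fun z hz => ?_
      have := h.mulVec_link y hz
      rw [hM] at this
      linarith
    rw [Finset.sum_const, nsmul_eq_mul] at h1
    have h2 : (∑ z ∈ chainLink W (i + 1), y z) / (chainLink W (i + 1)).card =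
        1 - (∑ u ∈ W i, y u + ∑ u ∈ W (i + 1), y u - ∑ u ∈ chainLink W (i + 1), y u) := by
      rw [div_eq_iff hn.ne']
      linarith
    rw [h2]
    ring
  k_first := Finset.card_pos.mpr ⟨_, h.first_mem_own hr⟩
  k_last := Finset.card_pos.mpr ⟨_, h.last_mem_own hr⟩

omit [Fintype S] in
lemma exists_vector (h : ZigzagCover v W r) (a b : ℕ → ℝ) :
    ∃ x : S → ℝ, (∀ i, ∀ z ∈ chainOwn W i, x z = a i) ∧
      ∀ i, ∀ z ∈ chainLink W (i + 1), x z = b (i + 1) := by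
  classical
  refine ⟨fun z => if z ∈ W (Nat.find (h.cover z) + 1) then b (Nat.find (h.cover z) + 1)
    else a (Nat.find (h.cover z)), ?_, ?_⟩
  · intro i z hz
    have hi : Nat.find (h.cover z) = i := h.eq_of_mem_own hz (Nat.find_spec (h.cover z))
    simp only [hi]
    rw [if_neg]
    intro hz'
    have := h.eq_of_mem_own hz hz'
    omega
  · intro i z hz
    have hi : Nat.find (h.cover z) = i := by
      refine (Nat.find_eq_iff _).mpr ⟨(Finset.mem_inter.mp hz).1, fun j hj hzj => ?_⟩
      rcases h.eq_or_eq_of_mem_link hz hzj with e | e <;> omega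
    simp only [hi]
    rw [if_pos (Finset.mem_inter.mp hz).2]

/-- Positive definiteness in terms of the masses of the links. -/
lemma link_form_pos (h : ZigzagCover v W r)
    (hK : ∀ h : S → ℝ, h ≠ 0 → 0 < h ⬝ᵥ posetGram S *ᵥ h)
    {γ X : ℕ → ℝ} (h0 : γ 0 = 0) (hr : γ r = 0) (hne : ∃ i, 0 < i ∧ i < r ∧ γ i ≠ 0)
    (hX : ∀ i < r, (((chainOwn W i).card : ℝ) + 1) * X i = γ i + γ (i + 1)) :
    0 < ∑ i ∈ range r, γ (i + 1) *
      (γ (i + 1) / (chainLink W (i + 1)).card - γ (i + 1) + X i + X (i + 1)) := by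
  -- The value -X i makes Mx vanish on own elements, so only the links contribute to the form.
  obtain ⟨x, hown, hlink⟩ := h.exists_vector (fun i => -X i)
    (fun i => γ i / (chainLink W i).card)
  have hlinkS : ∀ i ≤ r, ∑ z ∈ chainLink W i, x z = γ i := by
    intro i hi
    rcases Nat.eq_zero_or_pos i with rfl | hpos
    · simp [chainLink, h0]
    rcases Nat.lt_or_eq_of_le hi with hi | rfl
    · obtain ⟨j, rfl⟩ : ∃ j, i = j + 1 := ⟨i - 1, by omega⟩
      rw [Finset.sum_congr rfl (hlink j), Finset.sum_const, nsmul_eq_mul]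
      have := h.link_card_pos hpos hi
      field_simp
    · rw [h.link_eq_empty, Finset.sum_empty, hr]
  have hchain : ∀ i < r, ∑ z ∈ W i, x z = X i := by
    intro i hi
    rw [h.sum_chain, Finset.sum_congr rfl (hown i), Finset.sum_const, nsmul_eq_mul,
      hlinkS i hi.le, hlinkS (i + 1) hi]
    linarith [hX i hi]
  have hx0 : x ≠ 0 := by
    rintro rfl
    obtain ⟨i, hi0, hir, hγ⟩ := hne
    apply hγ
    rw [← hlinkS i hir.le]
    simp
  have hpos := hK x hx0
  rw [dotProduct, h.sum_eq] at hpos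
  refine hpos.trans_le (le_of_eq (Finset.sum_congr rfl fun i hi => ?_))
  rw [Finset.mem_range] at hi
  have h1 : ∑ z ∈ chainOwn W i, x z * (posetGram S *ᵥ x) z = 0 := by
    refine Finset.sum_eq_zero fun z hz => ?_
    rw [h.mulVec_own x hz, hchain i hi, hown i z hz]
    ring
  rw [h1, zero_add]
  rcases Nat.lt_or_eq_of_le (Nat.succ_le_of_lt hi) with hi' | hi'
  · have h2 : ∀ z ∈ chainLink W (i + 1), x z * (posetGram S *ᵥ x) z =
        x z * (γ (i + 1) / (chainLink W (i + 1)).card - γ (i + 1) + X i + X (i + 1)) := by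
      intro z hz
      rw [h.mulVec_link x hz, hchain i hi, hchain (i + 1) hi', hlinkS (i + 1) hi, hlink i z hz]
      ring
    rw [Finset.sum_congr rfl h2, ← Finset.sum_mul, hlinkS (i + 1) hi]
  · have e : i + 1 = r := hi'
    rw [e, h.link_eq_empty, Finset.sum_empty, hr]
    ring

end ZigzagCover

end Masses

/-! ### Tent-shaped test vectors -/

/-- An alternating vector on the links growing linearly up to `l`, of constant modulus up to `l'`
and decreasing linearly afterwards. -/
lemma exists_tent (k n : ℕ → ℕ) {r l l' : ℕ} (hl : 0 < l) (hll : l ≤ l') (hr : l' < r) :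
    ∃ γ X : ℕ → ℝ, γ 0 = 0 ∧ γ r = 0 ∧ γ l ≠ 0 ∧
      (∀ i < r, ((k i : ℝ) + 1) * X i = γ i + γ (i + 1)) ∧
      ∑ i ∈ range r, γ (i + 1) * (γ (i + 1) / n (i + 1) - γ (i + 1) + X i + X (i + 1)) ≤
        (1 / legSize k l - (1 - 1 / (n l : ℝ))) +
        (1 / legSize (fun t => k (r - 1 - t)) (r - l') -
          if l = l' then 0 else (1 - 1 / (n l' : ℝ))) := by
  set k' : ℕ → ℕ := fun t => k (r - 1 - t) with hk'
  have pos : ∀ (k : ℕ → ℕ) {j : ℕ}, 0 < j → (0 : ℝ) < legSize k j := by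
    intro k j hj
    obtain ⟨i, rfl⟩ : ∃ i, j = i + 1 := ⟨j - 1, by omega⟩
    exact_mod_cast (by rw [legSize_succ]; omega : 0 < legSize k (i + 1))
  have hN := pos k hl
  have hN' := pos k' (j := r - l') (by omega)
  -- τ is the modulus of γ, linear when position is measured by `legSize` from the nearer end; ξ is
  -- minus its slope, constant on each of the three stretches.
  set τ : ℕ → ℝ := fun j => if j ≤ l then legSize k j / legSize k l else
    if j ≤ l' then 1 else legSize k' (r - j) / legSize k' (r - l') with hτ
  set ξ : ℕ → ℝ := fun j => if j < l then -(1 / legSize k l) else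
    if j < l' then 0 else 1 / legSize k' (r - l') with hξ
  have τ_left : ∀ j ≤ l, τ j = legSize k j / legSize k l := fun j hj => by simp [hτ, hj]
  have τ_mid : ∀ j, l ≤ j → j ≤ l' → τ j = 1 := by
    intro j h1 h2
    rcases Nat.lt_or_eq_of_le h1 with h1 | rfl
    · simp [hτ, not_le.mpr h1, h2]
    · rw [τ_left l le_rfl, div_self hN.ne']
  have τ_right : ∀ j, l' ≤ j → τ j = legSize k' (r - j) / legSize k' (r - l') := by
    intro j h1
    rcases Nat.lt_or_eq_of_le h1 with h1 | rfl
    · simp [hτ, not_le.mpr h1, not_le.mpr (hll.trans_lt h1)]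
    · rw [τ_mid l' hll le_rfl, div_self hN'.ne']
  have hsq : ∀ j : ℕ, ((-1 : ℝ) ^ j) * (-1) ^ j = 1 := by
    intro j
    rw [← mul_pow]
    norm_num
  refine ⟨fun j => (-1) ^ j * τ j, fun j => (-1) ^ j * ξ j, ?_, ?_, ?_, ?_, ?_⟩
  · simp [τ_left 0 (by omega), legSize_zero]
  · simp [τ_right r hr.le, legSize_zero]
  · simp only [τ_mid l le_rfl hll, mul_one]
    exact pow_ne_zero _ (by norm_num)
  · intro i hi
    have key : ((k i : ℝ) + 1) * ξ i = τ i - τ (i + 1) := by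
      rcases Nat.lt_or_ge i l with h1 | h1
      · rw [τ_left i h1.le, τ_left (i + 1) h1, legSize_succ]
        simp only [hξ, if_pos h1]
        push_cast
        field_simp
        ring
      · rcases Nat.lt_or_ge i l' with h2 | h2
        · rw [τ_mid i h1 h2.le, τ_mid (i + 1) (by omega) h2]
          simp [hξ, not_lt.mpr h1, h2]
        · rw [τ_right i h2, τ_right (i + 1) (by omega), show r - i = r - (i + 1) + 1 by omega,
            legSize_succ]
          have : k' (r - (i + 1)) = k i := by
            simp only [hk']
            rw [show r - 1 - (r - (i + 1)) = i by omega]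
          rw [this]
          simp only [hξ, if_neg (not_lt.mpr h1), if_neg (not_lt.mpr h2)]
          push_cast
          field_simp
          ring
    simp only [pow_succ]
    linear_combination (-1 : ℝ) ^ i * key
  · have hD : ∀ j, (0 : ℝ) ≤ 1 - 1 / (n j : ℝ) := by
      intro j
      have : 1 / (n j : ℝ) ≤ 1 := by
        rcases Nat.eq_zero_or_pos (n j) with h | h
        · rw [h]; norm_num
        · rw [div_le_one (by exact_mod_cast h)]
          exact_mod_cast h
      linarith
    have hstep : ∀ i, ξ (i + 1) - ξ i = (if i + 1 = l then 1 / (legSize k l : ℝ) else 0) +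
        (if i + 1 = l' then 1 / (legSize k' (r - l') : ℝ) else 0) := by
      intro i
      simp only [hξ]
      split_ifs <;> first | omega | ring
    have hterm : ∀ i ∈ range r, (-1 : ℝ) ^ (i + 1) * τ (i + 1) *
        ((-1) ^ (i + 1) * τ (i + 1) / n (i + 1) - (-1) ^ (i + 1) * τ (i + 1) + (-1) ^ i * ξ i
          + (-1) ^ (i + 1) * ξ (i + 1)) ≤
        (if i + 1 = l then (1 / legSize k l - (1 - 1 / (n l : ℝ))) else 0) +
        (if i + 1 = l' then (1 / legSize k' (r - l') -
          if l = l' then 0 else (1 - 1 / (n l' : ℝ))) else 0) := by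
      intro i _
      have e : (-1 : ℝ) ^ (i + 1) * τ (i + 1) *
        ((-1) ^ (i + 1) * τ (i + 1) / n (i + 1) - (-1) ^ (i + 1) * τ (i + 1) + (-1) ^ i * ξ i
          + (-1) ^ (i + 1) * ξ (i + 1)) =
          τ (i + 1) * (ξ (i + 1) - ξ i) - τ (i + 1) ^ 2 * (1 - 1 / n (i + 1)) := by
        have := hsq i
        rw [pow_succ]
        linear_combination (τ (i + 1) ^ 2 / n (i + 1) - τ (i + 1) ^ 2 - τ (i + 1) * ξ i
          + τ (i + 1) * ξ (i + 1)) * this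
      -- The slope jumps only at l and l', where τ = 1; every other link contributes a nonpositive
      -- term. When l = l' both jumps occur at one link, whose defect must be subtracted only once.
      rw [e, hstep]
      by_cases h1 : i + 1 = l
      · rw [h1, τ_mid l le_rfl hll]
        by_cases h2 : l = l'
        · simp only [h2, if_true]
          linarith
        · simp only [h2, if_true, if_false]
          linarith
      · by_cases h2 : i + 1 = l'
        · rw [h2, τ_mid l' hll le_rfl]
          have h3 : ¬ l' = l := fun h => h1 (h2.trans h)
          simp only [h3, Ne.symm h3, if_true, if_false]
          linarith
        · simp only [h1, h2, if_false]
          have := mul_nonneg (sq_nonneg (τ (i + 1))) (hD (i + 1))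
          linarith
    refine (Finset.sum_le_sum hterm).trans (le_of_eq ?_)
    have pick : ∀ (j : ℕ) (c : ℝ), 0 < j → j < r →
        ∑ i ∈ range r, (if i + 1 = j then c else 0) = c := by
      intro j c h0 hj
      rw [Finset.sum_eq_single_of_mem (j - 1) (Finset.mem_range.mpr (by omega))]
      · rw [if_pos (by omega)]
      · intro i _ hi
        rw [if_neg (by omega)]
    rw [Finset.sum_add_distrib, pick l _ hl (by omega), pick l' _ (by omega) hr]

/-! ### Assembling the wattle -/

section Final

variable {S : Type*} [PartialOrder S] [DecidableEq S]

namespace ZigzagCover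

variable {v : ℕ → S} {W : ℕ → Finset S} {r : ℕ}

/-- All links are single elements, the number of chains is odd, and every second chain has no
elements of its own. -/
lemma link_card_and_parity [Fintype S] (h : ZigzagCover v W r) (hr : 2 ≤ r)
    (hK : ∀ h : S → ℝ, h ≠ 0 → 0 < h ⬝ᵥ posetGram S *ᵥ h) {y : S → ℝ} (hy : ∀ s, 0 < y s)
    (hM : ∀ s, (posetGram S *ᵥ y) s = 1) :
    (∀ i, 0 < i → i < r → chainLink W i = {v i}) ∧ Odd r ∧
      ∀ i < r, Odd i → chainOwn W i = ∅ := by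
  have hdata := h.chainData hr hy hM
  have hpd : ∀ l l', 0 < l → l ≤ l' → l' < r → 0 <
      (1 / legSize (fun i => (chainOwn W i).card) l - (1 - 1 / ((chainLink W l).card : ℝ))) +
      (1 / legSize (fun t => (chainOwn W (r - 1 - t)).card) (r - l') -
        if l = l' then 0 else (1 - 1 / ((chainLink W l').card : ℝ))) := by
    intro l l' h0 hll hl'
    obtain ⟨γ, X, h1, h2, h3, h4, h5⟩ := exists_tent (fun i => (chainOwn W i).card)
      (fun i => (chainLink W i).card) h0 hll hl'
    exact (h.link_form_pos hK h1 h2 ⟨l, h0, by omega, h3⟩ h4).trans_le h5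
  have hone := hdata.link_size_eq_one
    (fun l h0 hl => by
      have := hpd l l h0 le_rfl hl
      rw [if_pos rfl] at this
      linarith)
    (fun l l' h0 hll hl' => by
      have := hpd l l' h0 hll.le hl'
      rw [if_neg hll.ne] at this
      linarith)
  obtain ⟨hodd, hempty⟩ := hdata.parity hr hone
  refine ⟨fun i h0 hi => ?_, hodd, fun i hi ho => Finset.card_eq_zero.mp (hempty i hi ho)⟩
  obtain ⟨z, hz⟩ := Finset.card_eq_one.mp (hone i h0 hi)
  have := h.endpoint_mem_link h0 hi
  rw [hz, Finset.mem_singleton] at this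
  rw [hz, this]

omit [DecidableEq S] in
lemma not_isMax_of_isMin (h : ZigzagCover v W r) {i : ℕ} (hi : i < r) (h1 : IsMin (v i)) :
    ¬ IsMax (v i) := by
  intro h2
  have hne : v i ≠ v (i + 1) := fun e => by
    have := h.inj i (by omega) (i + 1) (by omega) e
    omega
  rcases (h.comparable_iff _ _).mpr ⟨i, h.left_mem i hi, h.right_mem i hi⟩ with e | e
  · exact hne (h2.eq_of_le e)
  · exact hne (h1.eq_of_le e).symm

omit [DecidableEq S] in
lemma isMax_last (h : ZigzagCover v W r) (h0 : ¬ IsMax (v 0)) (hodd : Odd r) : IsMax (v r) := by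
  have hpar : ∀ i < r, (Even i → IsMax (v (i + 1))) ∧ (Odd i → IsMin (v (i + 1))) := by
    intro i
    induction i with
    | zero =>
      refine fun hi => ⟨fun _ => ?_, fun h => by simp at h⟩
      rcases h.extremal 0 hi with h3 | h3
      · exact h3.2
      · exact absurd h3.1 h0
    | succ i ih =>
      intro hi
      obtain ⟨h1, h2⟩ := ih (by omega)
      constructor
      · intro he
        have hmin := h2 (by simpa [Nat.even_add_one] using he)
        rcases h.extremal (i + 1) hi with h3 | h3
        · exact h3.2
        · exact absurd h3.1 (h.not_isMax_of_isMin hi hmin)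
      · intro ho
        have hmax := h1 (by simpa [Nat.odd_add_one] using ho)
        rcases h.extremal (i + 1) hi with h3 | h3
        · exact absurd hmax (h.not_isMax_of_isMin hi h3.1)
        · exact h3.2
  obtain ⟨t, rfl⟩ := hodd
  exact (hpar (2 * t) (by omega)).1 (even_two_mul t)

omit [DecidableEq S] in
lemma isMin_isMax_of_parity (h : ZigzagCover v W r) (h0 : IsMax (v 0)) :
    ∀ i ≤ r, (Even i → IsMax (v i)) ∧ (Odd i → IsMin (v i)) := by
  intro i
  induction i with
  | zero => exact fun _ => ⟨fun _ => h0, fun h => by simp at h⟩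
  | succ i ih =>
    intro hi
    obtain ⟨h1, h2⟩ := ih (by omega)
    constructor
    · intro he
      have hmin := h2 (by simpa [Nat.even_add_one] using he)
      rcases h.extremal i (by omega) with h3 | h3
      · exact h3.2
      · exact absurd h3.1 (h.not_isMax_of_isMin (by omega) hmin)
    · intro ho
      have hmax := h1 (by simpa [Nat.odd_add_one] using ho)
      rcases h.extremal i (by omega) with h3 | h3
      · exact absurd hmax (h.not_isMax_of_isMin (by omega) h3.1)
      · exact h3.2

/-- The even-indexed chains are the Z_i. An odd-indexed chain is {v (2i+1), v (2i+2)} and supplies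
the single comparison between Z_i and Z_{i+1}; since v 0 is maximal, it goes from the least element
of Z_i to the greatest of Z_{i+1}. -/
lemma isWattle (h : ZigzagCover v W r) (hr : 2 ≤ r) (h0 : IsMax (v 0))
    (hlink : ∀ i, 0 < i → i < r → chainLink W i = {v i}) (hodd : Odd r)
    (hown : ∀ i < r, Odd i → chainOwn W i = ∅) : IsWattle S := by
  have hpar := h.isMin_isMax_of_parity h0
  obtain ⟨t, ht⟩ := hodd
  have mem_link : ∀ {z i}, 0 < i → z ∈ W i → z ∈ W (i - 1) → z = v i := by
    intro z i hi h1 h2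
    have hir := h.lt_of_mem h1
    obtain ⟨j, rfl⟩ : ∃ j, i = j + 1 := ⟨i - 1, by omega⟩
    have : z ∈ chainLink W (j + 1) := Finset.mem_inter.mpr ⟨h2, h1⟩
    rw [hlink _ hi hir, Finset.mem_singleton] at this
    exact this
  refine ⟨t + 1, fun i => W (2 * i), by omega, ?_, ?_, ?_, ?_, ?_⟩
  · intro s
    obtain ⟨i, hi⟩ := h.cover s
    have hir := h.lt_of_mem hi
    have hex : ∃ j, s ∈ W (2 * j) := by
      rcases Nat.even_or_odd' i with ⟨j, rfl | rfl⟩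
      · exact ⟨j, hi⟩
      · rcases mem_own_or_mem_link hi with h1 | h1 | h1
        · rw [hown _ hir ⟨j, rfl⟩] at h1
          simp at h1
        · exact ⟨j, (Finset.mem_inter.mp h1).1⟩
        · exact ⟨j + 1, (Finset.mem_inter.mp h1).2⟩
    obtain ⟨j, hj⟩ := hex
    have := h.lt_of_mem hj
    exact ⟨⟨j, by omega⟩, hj⟩
  · intro i j hij
    rw [Finset.disjoint_left]
    intro z hi hj
    have hne : (i : ℕ) ≠ j := fun e => hij (Fin.ext e)
    rcases Nat.lt_or_gt_of_ne hne with hlt | hlt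
    · have := h.consecutive z _ _ hi hj (by omega)
      omega
    · have := h.consecutive z _ _ hj hi (by omega)
      omega
  · intro i z hz u hu _
    exact (h.comparable_iff z u).mpr ⟨_, hz, hu⟩
  · intro i
    have hi : 2 * (i : ℕ) < r := by have := i.2; omega
    exact Finset.one_lt_card.mpr ⟨_, h.left_mem _ hi, _, h.right_mem _ hi, fun e => by
      have := h.inj _ hi.le _ (by omega) e
      omega⟩
  · intro i j hij a ha b hb
    have hi : 2 * (i : ℕ) < r := by have := i.2; omega
    have hj : 2 * (j : ℕ) < r := by have := j.2; omega
    have hne : (i : ℕ) ≠ j := fun e => hij (Fin.ext e)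
    have least : IsLeast (W (2 * (i : ℕ)) : Set S) (v (2 * i + 1)) := by
      refine ⟨h.right_mem _ hi, fun z hz => ?_⟩
      have hmin := (hpar (2 * i + 1) (by omega)).2 ⟨_, rfl⟩
      rcases (h.comparable_iff _ _).mpr ⟨_, h.right_mem _ hi, hz⟩ with e | e
      · exact e
      · exact hmin e
    have greatest : IsGreatest (W (2 * (j : ℕ)) : Set S) (v (2 * j)) := by
      refine ⟨h.left_mem _ hj, fun z hz => ?_⟩
      have hmax := (hpar (2 * j) (by omega)).1 (even_two_mul _)
      rcases (h.comparable_iff _ _).mpr ⟨_, h.left_mem _ hj, hz⟩ with e | e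
      · exact hmax e
      · exact e
    constructor
    · intro hab
      obtain ⟨p, hap, hbp⟩ := (h.comparable_iff a b).mp (Or.inl hab.le)
      have hpr := h.lt_of_mem hap
      have hpi : p = 2 * i + 1 ∨ p + 1 = 2 * i := by
        rcases lt_trichotomy p (2 * i) with e | e | e
        · exact Or.inr (h.consecutive a _ _ hap ha e).symm
        · subst e
          exfalso
          rcases Nat.lt_or_gt_of_ne hne with hlt | hlt
          · have := h.consecutive b _ _ hbp hb (by omega)
            omega
          · have := h.consecutive b _ _ hb hbp (by omega)
            omega
        · exact Or.inl (h.consecutive a _ _ ha hap e)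
      have hpj : p = 2 * j + 1 ∨ p + 1 = 2 * j := by
        rcases lt_trichotomy p (2 * j) with e | e | e
        · exact Or.inr (h.consecutive b _ _ hbp hb e).symm
        · omega
        · exact Or.inl (h.consecutive b _ _ hb hbp e)
      -- The chain containing both a and b is the odd one between Z_i and Z_j. If j precedes i, then
      -- a is a maximal element, which rules out a < b.
      rcases hpi with hpi | hpi <;> rcases hpj with hpj | hpj
      · omega
      · have hja : a = v (2 * i + 1) := by
          rw [← hpi]
          refine mem_link (by omega) hap ?_
          rwa [show p - 1 = 2 * i by omega]
        have hjb : b = v (2 * j) := by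
          refine mem_link (by omega) hb ?_
          rwa [show 2 * (j : ℕ) - 1 = p by omega]
        subst hja hjb
        exact ⟨by omega, least, greatest⟩
      · have hja : a = v (2 * i) := by
          refine mem_link (by omega) ha ?_
          rwa [show 2 * (i : ℕ) - 1 = p by omega]
        exact absurd hab (hja ▸ ((hpar (2 * i) (by omega)).1 (even_two_mul _)).not_lt)
      · omega
    · rintro ⟨hji, hla, hgb⟩
      have ea : a = v (2 * i + 1) := hla.unique least
      have eb : b = v (2 * j) := hgb.unique greatest
      have hne' : v (2 * i + 1) ≠ v (2 * j) := fun e => by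
        have := h.inj _ (by omega) _ (by omega) e
        omega
      have hmin := (hpar (2 * i + 1) (by omega)).2 ⟨_, rfl⟩
      rw [ea, eb]
      refine lt_of_le_of_ne ?_ hne'
      have hmem := h.right_mem (2 * i + 1) (by omega)
      rw [show 2 * (i : ℕ) + 1 + 1 = 2 * j by omega] at hmem
      rcases (h.comparable_iff _ _).mpr ⟨_, h.left_mem (2 * i + 1) (by omega), hmem⟩ with e | e
      · exact e
      · exact hmin e

end ZigzagCover

end Final

theorem proposition7 {S : Type*} [Fintype S] [PartialOrder S]
    (hconn : (SimpleGraph.hasse S).Connected)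
    (hpsd : ∀ x : S → ℝ, 0 ≤ posetForm S x)
    (hC : CSet (posetForm S) = ∅) :
    IsChain (· ≤ ·) (Set.univ : Set S) ∨ IsWattle S := by
  classical
  have hK : ∀ h : S → ℝ, h ≠ 0 → 0 < h ⬝ᵥ posetGram S *ᵥ h :=
    fun h h0 => dotProduct_mulVec_pos hpsd hC h0
  have hN : ∀ h : S → ℝ, h ≠ 0 → (∀ s, 0 ≤ (posetGram S *ᵥ h) s) → 0 < ∑ s, h s :=
    fun h h0 hM => sum_pos_of_mulVec_nonneg hC h0 hM
  rcases exists_zigzagCover hconn hK hN with hchain | ⟨v, W, r, hr, h⟩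
  · exact Or.inl fun s _ t _ _ => hchain s t
  right
  obtain ⟨y, hy, hM⟩ := exists_pos_mulVec_eq_one hpsd hC
  obtain ⟨h1, h2, h3⟩ := h.link_card_and_parity hr hK hy hM
  by_cases h0 : IsMax (v 0)
  · exact h.isWattle hr h0 h1 h2 h3
  -- As r is odd, the two ends of the path are of opposite kinds, so reversing puts a maximal
  -- element first.
  · have h' := h.reverse
    obtain ⟨h1', h2', h3'⟩ := h'.link_card_and_parity hr hK hy hM
    exact h'.isWattle hr (h.isMax_last h0 h2) h1' h2' h3'
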